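/- Let $k\ge 1$ be fixed. For $n\ge 0$ let $\mathcal B_{kn}^k$ be the group of all permutations of $\{1,\dots,kn\}$ that send each block $p_k(i)=\{(i-1)k+1,\dots,ik\}$ ($1\le i\le n$) onto some block; it is isomorphic to $\mathcal S_k\wr\mathcal S_n$. Every $\omega\in\mathcal B_{kn}^k$ induces a permutation $p_\omega$ of the $n$ blocks, and for a block $p_k(i)$ the nonempty intersections of $p_k(i)$ with the cycles of $\omega$ have cardinalities which form a partition $\rho$ of $k$; this $\rho$ is the same for all blocks in one cycle of $p_\omega$. The type of $\omega$ is the family of partitions $(\omega(\rho))_{\rho\vdash k}$, where the parts of $\omega(\rho)$ are the lengths of the cycles of $p_\omega$ (fixed points included) whose blocks yield $\rho$. For a family of partitions $x=(x(\rho))_{\rho\vdash k}$ put $|x|=\sum_{\rho\vdash k}|x(\rho)|$, and call $x$ proper if $x(1^k)$ has no part equal to $1$. For a proper family $x$ and $n\ge|x|$ let $\mathbf C_x(n)\in\mathbb C[\mathcal B_{kn}^k]$ be the sum of all elements of $\mathcal B_{kn}^k$ whose type is $x$ with $x(1^k)$ replaced by $x(1^k)\cup(1^{n-|x|})$. These are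 sums over the conjugacy classes of $\mathcal B_{kn}^k$ and span the center of the group algebra. The structure coefficients $c_{xy}^h(n)$ are defined by $$\mathbf C_x(n)\,\mathbf C_y(n)=\sum_{h}c_{xy}^h(n)\,\mathbf C_h(n),$$ where $h$ runs over the proper families with $|h|\le n$ (such coefficients exist and are unique). **Theorem.** Let $x,y,h$ be proper families of partitions indexed by the partitions of $k$. There is a polynomial $P\in\mathbb Q[X]$, a finite linear combination with non-negative rational coefficients of the falling factorials $$(X-|h|)(X-|h|-1)\cdots(X-|h|-j+1),\qquad j\ge 0,$$ such that $c_{xy}^h(n)=P(n)$ for every integer $n>\max(|x|,|y|,|h|)$. Moreover $\deg P\le |x|+|y|-|h|$ (with $\deg 0=-\infty$). -/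

import Mathlib

namespace BlockPerm

/-- The `i`-th block of `k` consecutive elements among `n * k` points (all 0-indexed):
the points `i * k, i * k + 1, …, i * k + (k - 1)`. -/
def block (n k : ℕ) (i : Fin n) : Finset (Fin (n * k)) :=
  Finset.univ.filter fun a => a.divNat = i

theorem card_block (n k : ℕ) (i : Fin n) : (block n k i).card = k := by
  have h : block n k i =
      (Finset.univ : Finset (Fin k)).map
        ⟨fun b => finProdFinEquiv (i, b), fun b c h => by simpa using h⟩ := by
    ext a
    simp only [block, Finset.mem_filter, Finset.mem_univ, true_and, Finset.mem_map]
    constructor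
    · intro h
      refine ⟨a.modNat, ?_⟩
      rw [← h]
      exact finProdFinEquiv.apply_symm_apply a
    · rintro ⟨b, rfl⟩
      exact congrArg Prod.fst (finProdFinEquiv.symm_apply_apply (i, b))
  rw [h]
  simp

/-- The group `B_{kn}^k` of the permutations of `n * k` points that send every block onto
a block. -/
def group (n k : ℕ) : Subgroup (Equiv.Perm (Fin (n * k))) where
  carrier := {w | ∀ r, ∃ r', (block n k r).map w.toEmbedding = block n k r'}
  one_mem' := fun r => ⟨r, Finset.map_refl⟩
  mul_mem' := by
    intro v w hv hw r
    obtain ⟨s, hs⟩ := hw r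
    obtain ⟨t, ht⟩ := hv s
    refine ⟨t, ?_⟩
    rw [← ht, ← hs, Finset.map_map]
    rfl
  inv_mem' := by
    intro w hw
    have hpow : ∀ (m : ℕ) (r : Fin n),
        ∃ r', (block n k r).map (w ^ m).toEmbedding = block n k r' := by
      intro m
      induction m with
      | zero => exact fun r => ⟨r, Finset.map_refl⟩
      | succ m ih =>
        intro r
        obtain ⟨s, hs⟩ := hw r
        obtain ⟨t, ht⟩ := ih s
        refine ⟨t, ?_⟩
        rw [← ht, ← hs, Finset.map_map]
        rfl
    have hinv : w⁻¹ = w ^ (orderOf w - 1) := by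
      rw [inv_eq_iff_mul_eq_one, ← pow_succ', Nat.sub_add_cancel (orderOf_pos w), pow_orderOf_eq_one]
    intro r
    rw [hinv]
    exact hpow _ r

instance decidableRelSetoid {m : ℕ} (w : Equiv.Perm (Fin m)) :
    DecidableRel (Equiv.Perm.SameCycle.setoid w) :=
  inferInstanceAs (DecidableRel w.SameCycle)

/-- The partition of `k` cut out on the block `i` by the cycles of `w`: its parts are the
cardinalities of the nonempty intersections of the block `i` with the cycles of `w`
(fixed points are cycles of length one). -/
def blockPartition {n k : ℕ} (w : Equiv.Perm (Fin (n * k))) (i : Fin n) :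
    k.Partition where
  parts := (Finpartition.ofSetSetoid (Equiv.Perm.SameCycle.setoid w)
    (block n k i)).parts.val.map Finset.card
  parts_pos := by
    intro m hm
    obtain ⟨s, hs, rfl⟩ := Multiset.mem_map.1 hm
    exact Finset.card_pos.2 (Finpartition.nonempty_of_mem_parts _ (Finset.mem_def.2 hs))
  parts_sum := by
    have h := (Finpartition.ofSetSetoid (Equiv.Perm.SameCycle.setoid w)
      (block n k i)).sum_card_parts
    rw [card_block] at h
    exact h

/-- The (indices of the) blocks met by those cycles of `w` that meet the block `i`.
For `w` in `group n k` this is the cycle through `i` of the permutation of the `n` blocks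
induced by `w`. -/
def blockCycle {n k : ℕ} (w : Equiv.Perm (Fin (n * k))) (i : Fin n) :
    Finset (Fin n) :=
  Finset.univ.filter fun j => ∃ a ∈ block n k i, ∃ b ∈ block n k j, w.SameCycle a b

/-- The type of `w`, a family of partitions (given by their multisets of parts) indexed by the
partitions `ρ` of `k`: every cycle `O` of the induced permutation of the blocks contributes one
part, its length, to the partition indexed by the partition of `k` that the cycles of `w` cut out
on the blocks in `O` (which is the same partition for all blocks in `O`, if `w` permutes the
blocks). -/
def type {n k : ℕ} (w : Equiv.Perm (Fin (n * k))) (ρ : k.Partition) :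
    Multiset ℕ :=
  ((Finset.univ.image (blockCycle w)).filter
    fun O => ∃ i ∈ O, blockPartition w i = ρ).val.map Finset.card

/-- A family of integer partitions (of arbitrary sizes) indexed by the partitions of `k`;
each one is given by its multiset of parts, which are positive. -/
@[ext]
structure Family (k : ℕ) where
  parts : k.Partition → Multiset ℕ
  parts_pos : ∀ ρ, ∀ m ∈ parts ρ, 0 < m

/-- The partition `(1^k)` of `k`. -/
def onesPartition (k : ℕ) : k.Partition where
  parts := Multiset.replicate k 1
  parts_pos := fun hm => by rw [Multiset.eq_of_mem_replicate hm]; exact Nat.one_pos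
  parts_sum := by simp

namespace Family

variable {k : ℕ}

/-- `|x|`, the sum of the sizes of all the partitions of the family `x`. -/
def size (x : Family k) : ℕ := ∑ ρ, (x.parts ρ).sum

/-- `x` is proper if the partition indexed by `(1^k)` has no part equal to `1`. -/
def Proper (x : Family k) : Prop := 1 ∉ x.parts (onesPartition k)

/-- For `|x| ≤ n`, the family of size `n` obtained from `x` by adding `n - |x|` parts equal to `1`
to the partition indexed by `(1^k)`. -/
def pad (x : Family k) (n : ℕ) : Family k where
  parts := fun ρ =>
    x.parts ρ + if ρ = onesPartition k then Multiset.replicate (n - x.size) 1 else 0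
  parts_pos := by
    intro ρ m hm
    rcases Multiset.mem_add.1 hm with h | h
    · exact x.parts_pos ρ m h
    · split_ifs at h
      · rw [Multiset.eq_of_mem_replicate h]; exact Nat.one_pos
      · simp at h

open Classical in
/-- The sum `𝐂_x(n)`, in the group algebra `ℂ[B_{kn}^k]`, of the elements of `B_{kn}^k` whose
type is `x` padded to the size `n`. -/
noncomputable def classSum (x : Family k) (n : ℕ) : MonoidAlgebra ℂ (group n k) :=
  ∑ t : group n k with type t.1 = (x.pad n).parts, MonoidAlgebra.of ℂ (group n k) t

/-- `c` is a family of structure coefficients for `x`, `y` and `n`: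
`𝐂_x(n) 𝐂_y(n) = ∑_z c_z 𝐂_z(n)`, where `z` runs over the proper families with `|z| ≤ n`. -/
def IsStructureCoeffs (x y : Family k) (n : ℕ) (c : Family k →₀ ℂ) : Prop :=
  (∀ z ∈ c.support, z.Proper ∧ z.size ≤ n) ∧
    x.classSum n * y.classSum n = c.sum fun z a => a • z.classSum n

end Family

end BlockPerm

namespace BlockPerm

open Finset

/-! The coefficient of a class sum in a product of two class sums counts factorizations. Delete from
the type of a permutation the parts that come from pointwise fixed blocks. What remains is a proper
family that no longer mentions n, and its size is the number of moved blocks (`size_reducedType`).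
Fix w of reduced type h. Then c(n) is the number of pairs (u, v) with u v = w and reduced types x
and y (`isStructureCoeffs_iff`).

Sort these pairs by the set U of blocks moved by u or v. It contains the |h| blocks moved by w and
has at most |x| + |y| elements. Everything outside U is fixed, so the pair lives on U alone, and the
number of pairs with a given U depends only on x, y, h and |U| (`coverCount_eq_fullCount`). There
are binomial(n - |h|, j) sets U with |h| + j elements. Hence c(n) is a sum over j ≤ |x| + |y| - |h|
of these binomials with coefficients in ℕ independent of n (`card_factorizations`). Each binomial is
a falling factorial of n - |h| divided by j!, which gives positivity and the degree bound.

Two facts about types support this: equal types imply conjugacy (`exists_conj_of_type_eq`), and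
every family is the type of some block permutation (`exists_type_eq`). For both, types are encoded
by two numbers: the points of a cycle in one block, and the blocks it meets. These are invariant
under `IsFiberEmbedding`, which covers conjugation as well as extension by the identity. -/

/-! ### Equivariant bijections between sets with a permutation -/

theorem color_zpow {X C : Type*} {σ : Equiv.Perm X} {θ : Equiv.Perm C} {c : X → C}
    (hc : ∀ x, c (σ x) = θ (c x)) (t : ℤ) (x : X) : c ((σ ^ t) x) = (θ ^ t) (c x) := by
  induction t generalizing x with
  | zero => simp
  | succ t ih => rw [zpow_add_one, zpow_add_one, Equiv.Perm.mul_apply, Equiv.Perm.mul_apply, ih, hc]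
  | pred t ih =>
    rw [zpow_sub_one, zpow_sub_one, Equiv.Perm.mul_apply, Equiv.Perm.mul_apply, ih]
    congr 1
    rw [Equiv.Perm.eq_inv_iff_eq, ← hc, ← Equiv.Perm.mul_apply, mul_inv_cancel,
      Equiv.Perm.one_apply]

/-- The rule σ^t x ↦ σ'^t x' is well defined on the cycle of x because the stabilizer of x is
contained in that of x'. -/
theorem exists_orbit_map {X X' : Type*} (σ : Equiv.Perm X) (σ' : Equiv.Perm X') (x : X) (x' : X')
    (h : ∀ t : ℤ, (σ ^ t) x = x → (σ' ^ t) x' = x') :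
    ∃ F : X → X', ∀ t : ℤ, F ((σ ^ t) x) = (σ' ^ t) x' := by
  classical
  refine ⟨fun y => if hy : ∃ t : ℤ, (σ ^ t) x = y then (σ' ^ hy.choose) x' else x', fun t => ?_⟩
  have hy : ∃ s : ℤ, (σ ^ s) x = (σ ^ t) x := ⟨t, rfl⟩
  simp only [dif_pos hy]
  have h1 := h (-t + hy.choose) (by
    rw [zpow_add, Equiv.Perm.mul_apply, hy.choose_spec, ← Equiv.Perm.mul_apply, ← zpow_add,
      neg_add_cancel, zpow_zero, Equiv.Perm.one_apply])
  rw [zpow_add, Equiv.Perm.mul_apply, zpow_neg, Equiv.Perm.inv_eq_iff_eq] at h1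
  exact h1

theorem mem_zpow_iff {X : Type*} {σ : Equiv.Perm X} {S : Finset X}
    (hS : ∀ x, σ x ∈ S ↔ x ∈ S) (t : ℤ) (x : X) : (σ ^ t) x ∈ S ↔ x ∈ S := by
  have := color_zpow (σ := σ) (θ := 1) (c := fun x => x ∈ S) (fun x => by simpa using hS x) t x
  simpa using this

/-- Two finite sets with a permutation and an equivariant colouring, with equally many points of
each colour and such that points of the same colour have the same stabilizers, are in equivariant
colour-preserving bijection. -/
theorem exists_equivariant_bijOn {X X' C : Type*} [Nonempty X'] {σ : Equiv.Perm X}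
    {σ' : Equiv.Perm X'} {θ : Equiv.Perm C} {c : X → C} {c' : X' → C} [DecidableEq C]
    (hc : ∀ x, c (σ x) = θ (c x)) (hc' : ∀ x, c' (σ' x) = θ (c' x))
    (hstab : ∀ x x', c x = c' x' → ∀ t : ℤ, (σ ^ t) x = x ↔ (σ' ^ t) x' = x') (m : ℕ) :
    ∀ (S : Finset X) (S' : Finset X'), S.card = m → (∀ x, σ x ∈ S ↔ x ∈ S) →
      (∀ x, σ' x ∈ S' ↔ x ∈ S') →
      (∀ γ, (S.filter fun x => c x = γ).card = (S'.filter fun x => c' x = γ).card) →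
      ∃ f : X → X', Set.BijOn f S S' ∧ ∀ x ∈ S, f (σ x) = σ' (f x) ∧ c' (f x) = c x := by
  classical
  induction m using Nat.strong_induction_on with
  | _ m ih =>
  intro S S' hm hS hS' hcount
  rcases S.eq_empty_or_nonempty with rfl | ⟨x, hx⟩
  · have : S' = ∅ := by
      rw [eq_empty_iff_forall_notMem]
      intro x' hx'
      have := hcount (c' x')
      rw [filter_empty, card_empty, eq_comm, card_eq_zero] at this
      exact notMem_empty x' (this ▸ mem_filter.2 ⟨hx', rfl⟩)
    subst this
    exact ⟨fun _ => Classical.arbitrary _, by simp, by simp⟩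
  -- Equal colour counts give x' of the same colour as x. Their cycles are matched by `F` and
  -- removed from S and S'; induction handles the rest.
  · obtain ⟨x', hx'⟩ : (S'.filter fun z => c' z = c x).Nonempty := by
      rw [← card_pos, ← hcount, card_pos]
      exact ⟨x, mem_filter.2 ⟨hx, rfl⟩⟩
    obtain ⟨hx', hcx⟩ := mem_filter.1 hx'
    have hst := hstab x x' hcx.symm
    obtain ⟨F, hF⟩ := exists_orbit_map σ σ' x x' fun t => (hst t).1
    set O := S.filter (σ.SameCycle x) with hO
    set O' := S'.filter (σ'.SameCycle x') with hO'
    have hFO : Set.BijOn F O O' := by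
      refine ⟨?_, ?_, ?_⟩
      · intro y hy
        obtain ⟨t, rfl⟩ := (mem_filter.1 hy).2
        rw [hF]
        exact mem_filter.2 ⟨(mem_zpow_iff hS' t x').2 hx', t, rfl⟩
      · intro y hy z hz hyz
        obtain ⟨t, rfl⟩ := (mem_filter.1 hy).2
        obtain ⟨s, rfl⟩ := (mem_filter.1 hz).2
        rw [hF, hF] at hyz
        have h1 := (hst (-s + t)).2 (by
          rw [zpow_add, Equiv.Perm.mul_apply, hyz, ← Equiv.Perm.mul_apply, ← zpow_add,
      neg_add_cancel, zpow_zero, Equiv.Perm.one_apply])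
        rw [zpow_add, Equiv.Perm.mul_apply, zpow_neg, Equiv.Perm.inv_eq_iff_eq] at h1
        exact h1
      · intro y hy
        obtain ⟨t, rfl⟩ := (mem_filter.1 hy).2
        exact ⟨(σ ^ t) x, mem_filter.2 ⟨(mem_zpow_iff hS t x).2 hx, t, rfl⟩, hF t⟩
    have hFc : ∀ y ∈ O, F (σ y) = σ' (F y) ∧ c' (F y) = c y := by
      intro y hy
      obtain ⟨t, rfl⟩ := (mem_filter.1 hy).2
      refine ⟨?_, ?_⟩
      · have := hF (1 + t)
        rw [hF]
        rwa [zpow_one_add, zpow_one_add] at this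
      · rw [hF, color_zpow hc, color_zpow hc', hcx]
    have hOσ : ∀ y, σ y ∈ O ↔ y ∈ O := by
      intro y
      simp only [hO, mem_filter, hS, Equiv.Perm.sameCycle_apply_right]
    have hOσ' : ∀ y, σ' y ∈ O' ↔ y ∈ O' := by
      intro y
      simp only [hO', mem_filter, hS', Equiv.Perm.sameCycle_apply_right]
    -- The two cycles have equal colour counts, so the hypothesis on counts survives their removal.
    have hOcount : ∀ γ, (O.filter fun x => c x = γ).card = (O'.filter fun x => c' x = γ).card := by
      intro γ
      refine card_bij (fun y _ => F y) ?_ ?_ ?_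
      · intro y hy
        obtain ⟨hy, hγ⟩ := mem_filter.1 hy
        rw [← hγ]
        exact mem_filter.2 ⟨hFO.mapsTo (mem_coe.2 hy), (hFc y hy).2⟩
      · intro y hy z hz h
        exact hFO.injOn (mem_filter.1 hy).1 (mem_filter.1 hz).1 h
      · intro z hz
        obtain ⟨hz, hγ⟩ := mem_filter.1 hz
        rw [← mem_coe] at hz
        obtain ⟨y, hy, rfl⟩ := hFO.surjOn hz
        exact ⟨y, mem_filter.2 ⟨hy, (hFc y hy).2 ▸ hγ⟩, rfl⟩
    have hOS : O ⊆ S := filter_subset _ _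
    have hOS' : O' ⊆ S' := filter_subset _ _
    have hxO : x ∈ O := mem_filter.2 ⟨hx, Equiv.Perm.SameCycle.refl _ _⟩
    obtain ⟨f, hf, hfc⟩ := ih (S \ O).card
      (hm ▸ card_lt_card (sdiff_ssubset hOS ⟨x, hxO⟩)) (S \ O) (S' \ O') rfl
      (fun y => by simp only [mem_sdiff, hS, hOσ]) (fun y => by simp only [mem_sdiff, hS', hOσ'])
      (fun γ => by
        have h1 := hcount γ
        rw [← sdiff_union_of_subset hOS, ← sdiff_union_of_subset hOS', filter_union, filter_union,
          card_union_of_disjoint, card_union_of_disjoint, hOcount] at h1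
        · exact Nat.add_right_cancel h1
        · exact disjoint_filter_filter sdiff_disjoint
        · exact disjoint_filter_filter sdiff_disjoint)
    refine ⟨fun y => if y ∈ O then F y else f y, ?_, ?_⟩
    · have h1 : Set.BijOn (fun y => if y ∈ O then F y else f y) (O : Set X) (O' : Set X') :=
        hFO.congr fun y hy => by simp [mem_coe.1 hy]
      have h2 : Set.BijOn (fun y => if y ∈ O then F y else f y)
          ((S \ O : Finset X) : Set X) ((S' \ O' : Finset X') : Set X') :=
        hf.congr fun y hy => by simp [(mem_sdiff.1 (mem_coe.1 hy)).2]
      rw [← sdiff_union_of_subset hOS, ← sdiff_union_of_subset hOS', coe_union, coe_union]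
      refine h2.union h1 ?_
      rw [Set.injOn_union]
      · refine ⟨h2.injOn, h1.injOn, fun y hy z hz h => ?_⟩
        have hy' := h2.mapsTo hy
        have hz' := h1.mapsTo hz
        rw [h] at hy'
        exact (mem_sdiff.1 (mem_coe.1 hy')).2 hz'
      · exact_mod_cast sdiff_disjoint
    · intro y hy
      by_cases hyO : y ∈ O
      · simpa [hOσ, hyO] using hFc y hyO
      · simpa [hOσ, hyO] using hfc y (mem_sdiff.2 ⟨hy, hyO⟩)

theorem exists_equivariant_equiv {X X' C : Type*} [Fintype X] [Fintype X'] {σ : Equiv.Perm X}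
    {σ' : Equiv.Perm X'} {θ : Equiv.Perm C} {c : X → C} {c' : X' → C} [DecidableEq C]
    (hc : ∀ x, c (σ x) = θ (c x)) (hc' : ∀ x, c' (σ' x) = θ (c' x))
    (hstab : ∀ x x', c x = c' x' → ∀ t : ℤ, (σ ^ t) x = x ↔ (σ' ^ t) x' = x')
    (hcount : ∀ γ, (univ.filter fun x => c x = γ).card = (univ.filter fun x => c' x = γ).card) :
    ∃ g : X ≃ X', ∀ x, g (σ x) = σ' (g x) ∧ c' (g x) = c x := by
  rcases isEmpty_or_nonempty X' with h | h
  · have : IsEmpty X := ⟨fun x => by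
      have h1 := hcount (c x)
      rw [univ_eq_empty (α := X'), filter_empty, card_empty, card_eq_zero] at h1
      exact notMem_empty x (h1 ▸ mem_filter.2 ⟨mem_univ x, rfl⟩)⟩
    exact ⟨Equiv.equivOfIsEmpty X X', fun x => (this.false x).elim⟩
  · obtain ⟨f, hf, hfc⟩ := exists_equivariant_bijOn hc hc' hstab _ univ univ rfl (by simp) (by simp)
      hcount
    rw [coe_univ, coe_univ, Set.bijOn_univ] at hf
    exact ⟨Equiv.ofBijective f hf, fun x => hfc x (mem_univ x)⟩

/-- Counting the points of `s` that lie in a class with `m` elements, when the classes partition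
`s`. -/
theorem mul_count_card_classes {I : Type*} [DecidableEq I] (s : Finset I) (f : I → Finset I)
    (hf : ∀ i ∈ s, ∀ j, j ∈ f i ↔ j ∈ s ∧ f j = f i) (m : ℕ) :
    m * ((s.image f).val.map card).count m = (s.filter fun i => (f i).card = m).card := by
  rw [Multiset.count_map, card_eq_sum_card_image f]
  have h1 : (s.filter fun i => (f i).card = m).image f = (s.image f).filter fun O => m = O.card := by
    ext O
    simp only [mem_image, mem_filter]
    constructor
    · rintro ⟨i, ⟨hi, h⟩, rfl⟩
      exact ⟨⟨i, hi, rfl⟩, h.symm⟩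
    · rintro ⟨⟨i, hi, rfl⟩, h⟩
      exact ⟨i, ⟨hi, h.symm⟩, rfl⟩
  rw [h1, sum_const_nat (m := m), mul_comm]
  · rfl
  · intro O hO
    obtain ⟨hO, h⟩ := mem_filter.1 hO
    obtain ⟨i, hi, rfl⟩ := mem_image.1 hO
    rw [h]
    congr 1
    ext j
    simp only [mem_filter, hf i hi j]
    constructor
    · rintro ⟨⟨hj, _⟩, h⟩
      exact ⟨hj, h⟩
    · rintro ⟨hj, h⟩
      exact ⟨⟨hj, by rw [h]⟩, h⟩


/-! ### Cycles of a permutation that respects a fibration -/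

section Fibred

variable {X I X' I' : Type*}

/-- The number of points that the cycle of `w` through `a` has in the fibre of `π` through `a`. -/
noncomputable def fiberOrbitCard (π : X → I) (w : Equiv.Perm X) (a : X) : ℕ :=
  Nat.card {b // π b = π a ∧ w.SameCycle a b}

/-- The number of fibres of `π` met by those cycles of `w` that meet the fibre over `i`. -/
noncomputable def baseOrbitCard (π : X → I) (w : Equiv.Perm X) (i : I) : ℕ :=
  Nat.card {j // ∃ a b, π a = i ∧ π b = j ∧ w.SameCycle a b}

/-- `(E, e)` identifies `π` with the restriction of `π'` to a set of whole fibres. -/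
structure IsFiberEmbedding (π : X → I) (π' : X' → I') (E : X → X') (e : I → I') : Prop where
  inj : Function.Injective E
  inj_base : Function.Injective e
  comm : ∀ a, π' (E a) = e (π a)
  full : ∀ b i, π' b = e i → ∃ a, E a = b

variable {π : X → I} {π' : X' → I'} {E : X → X'} {e : I → I'} {w : Equiv.Perm X}
  {w' : Equiv.Perm X'}

theorem sameCycle_map_iff (hE : Function.Injective E) (hw : ∀ a, E (w a) = w' (E a)) (a b : X) :
    w'.SameCycle (E a) (E b) ↔ w.SameCycle a b := by
  constructor
  · rintro ⟨t, h⟩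
    rw [← color_zpow (c := E) hw] at h
    exact ⟨t, hE h⟩
  · rintro ⟨t, rfl⟩
    exact ⟨t, (color_zpow (c := E) hw t a).symm⟩

namespace IsFiberEmbedding

theorem fiberOrbitCard_map (h : IsFiberEmbedding π π' E e) (hw : ∀ a, E (w a) = w' (E a)) (a : X) :
    fiberOrbitCard π' w' (E a) = fiberOrbitCard π w a := by
  symm
  refine Nat.card_congr (Equiv.ofBijective (fun b => ⟨E b.1, ?_, ?_⟩) ⟨?_, ?_⟩)
  · rw [h.comm, h.comm, b.2.1]
  · exact (sameCycle_map_iff h.inj hw _ _).2 b.2.2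
  · intro b c hbc
    exact Subtype.ext (h.inj (congrArg Subtype.val hbc))
  · rintro ⟨b, hb, hs⟩
    obtain ⟨c, rfl⟩ := h.full b (π a) (by rw [hb, h.comm])
    refine ⟨⟨c, h.inj_base ?_, (sameCycle_map_iff h.inj hw _ _).1 hs⟩, rfl⟩
    rw [← h.comm, ← h.comm, hb]

theorem baseOrbitCard_map (h : IsFiberEmbedding π π' E e) (hw : ∀ a, E (w a) = w' (E a)) (i : I) :
    baseOrbitCard π' w' (e i) = baseOrbitCard π w i := by
  symm
  refine Nat.card_congr (Equiv.ofBijective (fun j => ⟨e j.1, ?_⟩) ⟨?_, ?_⟩)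
  · obtain ⟨j, a, b, rfl, rfl, hs⟩ := j
    exact ⟨E a, E b, h.comm a, h.comm b, (sameCycle_map_iff h.inj hw _ _).2 hs⟩
  · intro b c hbc
    exact Subtype.ext (h.inj_base (congrArg Subtype.val hbc))
  · rintro ⟨j, a, b, ha, rfl, t, rfl⟩
    obtain ⟨a, rfl⟩ := h.full a i ha
    have ha' : π a = i := h.inj_base (by rw [← ha, h.comm])
    refine ⟨⟨π ((w ^ t) a), a, (w ^ t) a, ha', rfl, t, rfl⟩, Subtype.ext ?_⟩
    change e (π ((w ^ t) a)) = π' ((w' ^ t) (E a))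
    rw [← h.comm, color_zpow (c := E) hw]

end IsFiberEmbedding

/-- A permutation that maps fibres to fibres embeds π into itself. For w commuting with itself this
makes orbit counts constant along cycles; for another such permutation g it expresses conjugation by
g. -/
theorem isFiberEmbedding_self {p : Equiv.Perm I} (hp : ∀ a, π (w a) = p (π a)) :
    IsFiberEmbedding π π w p :=
  ⟨w.injective, p.injective, hp, fun b _ _ => w.surjective b⟩

theorem fiberOrbitCard_zpow {p : Equiv.Perm I} (hp : ∀ a, π (w a) = p (π a)) (t : ℤ) (a : X) :
    fiberOrbitCard π w ((w ^ t) a) = fiberOrbitCard π w a := by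
  have h := color_zpow (σ := w) (θ := 1) (c := fiberOrbitCard π w)
    (fun x => (isFiberEmbedding_self hp).fiberOrbitCard_map (fun _ => rfl) x) t a
  simpa using h

/-- The cycle length determines the stabilizer, so the stabilizer condition for equivariant
bijections reduces to comparing cycle lengths. -/
theorem zpow_apply_eq_self_iff [Finite X] (w : Equiv.Perm X) (a : X) (t : ℤ) :
    (w ^ t) a = a ↔ ((Nat.card {b // w.SameCycle a b} : ℕ) : ℤ) ∣ t := by
  classical
  have := Fintype.ofFinite X
  have h := MulAction.zpow_smul_eq_iff_minimalPeriod_dvd (a := w) (b := a) (n := t)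
  rw [MulAction.minimalPeriod_eq_card] at h
  rw [← Equiv.Perm.smul_def, h]
  rw [← Nat.card_eq_fintype_card]
  have : Nat.card (MulAction.orbit (Subgroup.zpowers w) a) = Nat.card {b // w.SameCycle a b} := by
    refine Nat.card_congr (Equiv.subtypeEquivRight fun b => ?_)
    constructor
    · rintro ⟨⟨_, s, rfl⟩, rfl⟩
      exact ⟨s, rfl⟩
    · rintro ⟨s, rfl⟩
      exact ⟨⟨w ^ s, s, rfl⟩, rfl⟩
  rw [this]

theorem baseOrbitCard_eq {p : Equiv.Perm I} (hp : ∀ a, π (w a) = p (π a))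
    (hπ : Function.Surjective π) (i : I) :
    baseOrbitCard π w i = Nat.card {j // p.SameCycle i j} := by
  refine Nat.card_congr (Equiv.subtypeEquivRight fun j => ?_)
  constructor
  · rintro ⟨a, b, rfl, rfl, t, rfl⟩
    exact ⟨t, (color_zpow (c := π) hp t a).symm⟩
  · rintro ⟨t, rfl⟩
    obtain ⟨a, rfl⟩ := hπ i
    exact ⟨a, (w ^ t) a, rfl, color_zpow (c := π) hp t a, t, rfl⟩

/-- The cycle of a lies over the cycle of π a in the base, and w carries its points in one fibre
bijectively to those in the next, so all these fibres contribute equally. -/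
theorem card_sameCycle [Finite X] {p : Equiv.Perm I} (hp : ∀ a, π (w a) = p (π a))
    (hπ : Function.Surjective π) (a : X) :
    Nat.card {b // w.SameCycle a b} = baseOrbitCard π w (π a) * fiberOrbitCard π w a := by
  classical
  have := Fintype.ofFinite X
  have := Finite.of_surjective π hπ
  have := Fintype.ofFinite I
  rw [baseOrbitCard_eq hp hπ, Nat.card_eq_fintype_card, Nat.card_eq_fintype_card,
    Fintype.card_subtype, Fintype.card_subtype,
    card_eq_sum_card_fiberwise (f := π) (t := univ.filter fun j => p.SameCycle (π a) j)]
  · refine sum_const_nat fun j hj => ?_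
    obtain ⟨t, rfl⟩ := (mem_filter.1 hj).2
    rw [← fiberOrbitCard_zpow hp t a, fiberOrbitCard, Nat.card_eq_fintype_card,
      Fintype.card_subtype]
    congr 1
    ext b
    simp only [mem_filter, mem_univ, true_and, color_zpow (c := π) hp,
      Equiv.Perm.sameCycle_zpow_left]
    exact and_comm
  · intro b hb
    obtain ⟨t, rfl⟩ := (mem_filter.1 hb).2
    exact mem_coe.2 (mem_filter.2 ⟨mem_univ _, t, (color_zpow (c := π) hp t a).symm⟩)

end Fibred

/-! ### Block partitions and types as counts of points and blocks -/

section Points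

variable {n k : ℕ}

theorem mem_block {i : Fin n} {a : Fin (n * k)} : a ∈ block n k i ↔ a.divNat = i := by
  simp [block]

theorem divNat_surjective (hk : 0 < k) : Function.Surjective (Fin.divNat : Fin (n * k) → Fin n) := by
  intro i
  obtain ⟨a, ha⟩ := card_pos.1 ((card_block n k i).symm ▸ hk)
  exact ⟨a, mem_block.1 ha⟩

theorem exists_base_perm (hk : 0 < k) {w : Equiv.Perm (Fin (n * k))} (hw : w ∈ group n k) :
    ∃ p : Equiv.Perm (Fin n), ∀ a, (w a).divNat = p a.divNat := by
  choose p hp using hw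
  have h : ∀ a, (w a).divNat = p a.divNat := by
    intro a
    rw [← mem_block, ← hp]
    exact mem_map_of_mem _ (mem_block.2 rfl)
  have hs : Function.Surjective p := by
    intro i
    obtain ⟨a, rfl⟩ := divNat_surjective hk i
    exact ⟨(w.symm a).divNat, by rw [← h, Equiv.apply_symm_apply]⟩
  exact ⟨Equiv.ofBijective p (Finite.injective_iff_bijective.1 (Finite.injective_iff_surjective.2 hs)),
    h⟩

theorem mem_group_of_base_map {w : Equiv.Perm (Fin (n * k))} (p : Fin n → Fin n)
    (h : ∀ a, (w a).divNat = p a.divNat) : w ∈ group n k := by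
  refine fun r => ⟨p r, eq_of_subset_of_card_le ?_ ?_⟩
  · intro b hb
    obtain ⟨a, ha, rfl⟩ := mem_map.1 hb
    exact mem_block.2 ((h a).trans (by rw [mem_block.1 ha]))
  · rw [card_map, card_block, card_block]

theorem card_blockCycle (w : Equiv.Perm (Fin (n * k))) (i : Fin n) :
    (blockCycle w i).card = baseOrbitCard Fin.divNat w i := by
  classical
  rw [baseOrbitCard, Nat.card_eq_fintype_card, Fintype.card_subtype]
  congr 1
  ext j
  simp only [blockCycle, mem_filter, mem_univ, true_and, mem_block]
  constructor
  · rintro ⟨a, ha, b, hb, h⟩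
    exact ⟨a, b, ha, hb, h⟩
  · rintro ⟨a, b, ha, hb, h⟩
    exact ⟨a, ha, b, hb, h⟩

/-- A part equal to m is a class of m points of the block, so counting points gives m times the
multiplicity. Counts of points, unlike multisets of classes, are easily transported along maps. -/
theorem mul_count_blockPartition (w : Equiv.Perm (Fin (n * k))) (i : Fin n) (m : ℕ) :
    m * (blockPartition w i).parts.count m =
      (univ.filter fun a : Fin (n * k) =>
        a.divNat = i ∧ fiberOrbitCard Fin.divNat w a = m).card := by
  classical
  have h := mul_count_card_classes (block n k i)
    (fun a => (block n k i).filter fun b => w.SameCycle a b) (fun a ha b => by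
      simp only [mem_filter]
      refine and_congr_right fun hb => ⟨fun h => ?_, fun h => ?_⟩
      · ext c
        simp only [mem_filter]
        exact and_congr_right fun _ => ⟨h.trans, h.symm.trans⟩
      · have : b ∈ (block n k i).filter fun c => w.SameCycle b c :=
          mem_filter.2 ⟨hb, Equiv.Perm.SameCycle.refl _ _⟩
        rw [h] at this
        exact (mem_filter.1 this).2) m
  refine Eq.trans ?_ (h.trans ?_)
  · congr 3
  · congr 1
    ext a
    simp only [mem_filter, mem_univ, true_and, mem_block]
    refine and_congr_right fun ha => ?_
    rw [fiberOrbitCard, Nat.card_eq_fintype_card, Fintype.card_subtype, ha]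
    have : (block n k i).filter (fun b => w.SameCycle a b) =
        univ.filter fun b : Fin (n * k) => b.divNat = i ∧ w.SameCycle a b := by
      ext b
      simp [mem_block]
    rw [this]

/-- The weighted multiplicities lose information only at m = 0, which positivity of the parts
excludes. -/
theorem multiset_eq_of_mul_count {s t : Multiset ℕ} (hs : ∀ m ∈ s, 0 < m) (ht : ∀ m ∈ t, 0 < m)
    (h : ∀ m, m * s.count m = m * t.count m) : s = t := by
  ext m
  rcases Nat.eq_zero_or_pos m with rfl | hm
  · rw [Multiset.count_eq_zero.2 fun h0 => (hs 0 h0).ne rfl,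
      Multiset.count_eq_zero.2 fun h0 => (ht 0 h0).ne rfl]
  · exact Nat.eq_of_mul_eq_mul_left hm (h m)

theorem blockPartition_eq_iff (w : Equiv.Perm (Fin (n * k))) (i : Fin n) (ρ : k.Partition) :
    blockPartition w i = ρ ↔ ∀ m, (univ.filter fun a : Fin (n * k) =>
        a.divNat = i ∧ fiberOrbitCard Fin.divNat w a = m).card = m * ρ.parts.count m := by
  constructor
  · rintro rfl m
    rw [mul_count_blockPartition]
  · intro h
    exact Nat.Partition.ext (multiset_eq_of_mul_count (fun _ => (blockPartition w i).parts_pos)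
      (fun _ => ρ.parts_pos) fun m => by rw [mul_count_blockPartition, h])

theorem IsFiberEmbedding.card_filter_map {X X' I I' : Type*} [Fintype X] [Fintype X']
    [DecidableEq I] [DecidableEq I'] {π : X → I} {π' : X' → I'} {E : X → X'} {e : I → I'}
    {w : Equiv.Perm X} {w' : Equiv.Perm X'} (h : IsFiberEmbedding π π' E e)
    (hw : ∀ a, E (w a) = w' (E a)) (i : I) (m : ℕ) :
    (univ.filter fun a => π' a = e i ∧ fiberOrbitCard π' w' a = m).card =
      (univ.filter fun a => π a = i ∧ fiberOrbitCard π w a = m).card := by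
  symm
  refine card_bij (fun a _ => E a) ?_ (fun a _ b _ hab => h.inj hab) ?_
  · intro a ha
    simp only [mem_filter, mem_univ, true_and] at ha ⊢
    rw [h.comm, h.fiberOrbitCard_map hw, ha.1, ha.2]
    exact ⟨rfl, rfl⟩
  · intro b hb
    simp only [mem_filter, mem_univ, true_and] at hb
    obtain ⟨a, rfl⟩ := h.full b i hb.1
    rw [h.comm, h.fiberOrbitCard_map hw] at hb
    exact ⟨a, mem_filter.2 ⟨mem_univ _, h.inj_base hb.1, hb.2⟩, rfl⟩

theorem IsFiberEmbedding.blockPartition_map {n' : ℕ} {E : Fin (n * k) → Fin (n' * k)}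
    {e : Fin n → Fin n'} {w : Equiv.Perm (Fin (n * k))} {w' : Equiv.Perm (Fin (n' * k))}
    (h : IsFiberEmbedding Fin.divNat Fin.divNat E e) (hw : ∀ a, E (w a) = w' (E a)) (i : Fin n) :
    blockPartition w' (e i) = blockPartition w i := by
  rw [blockPartition_eq_iff]
  intro m
  rw [h.card_filter_map hw, mul_count_blockPartition]

/-- The classes are now the cycles of the induced permutation p. The block partition is constant
along them, so the blocks with partition ρ form a union of classes. -/
theorem mul_count_type (hk : 0 < k) {w : Equiv.Perm (Fin (n * k))} (hw : w ∈ group n k)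
    (ρ : k.Partition) (m : ℕ) :
    m * (type w ρ).count m = (univ.filter fun i : Fin n =>
      blockPartition w i = ρ ∧ baseOrbitCard Fin.divNat w i = m).card := by
  classical
  obtain ⟨p, hp⟩ := exists_base_perm hk hw
  have hcyc : ∀ i j, j ∈ blockCycle w i ↔ p.SameCycle i j := by
    intro i j
    simp only [blockCycle, mem_filter, mem_univ, true_and, mem_block]
    constructor
    · rintro ⟨a, rfl, b, rfl, t, rfl⟩
      exact ⟨t, (color_zpow (c := Fin.divNat) hp t a).symm⟩
    · rintro ⟨t, rfl⟩
      obtain ⟨a, rfl⟩ := divNat_surjective hk i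
      exact ⟨a, rfl, (w ^ t) a, color_zpow (c := Fin.divNat) hp t a, t, rfl⟩
  have hbp : ∀ i j, p.SameCycle i j → blockPartition w j = blockPartition w i := by
    rintro i _ ⟨t, rfl⟩
    have h := color_zpow (σ := p) (θ := 1) (c := blockPartition w) (fun i =>
      (isFiberEmbedding_self hp).blockPartition_map (fun _ => rfl) i) t i
    simpa using h
  have hcyc' : ∀ i j, p.SameCycle i j ↔ blockCycle w j = blockCycle w i := by
    intro i j
    constructor
    · intro h
      ext l
      rw [hcyc, hcyc]
      exact ⟨h.trans, h.symm.trans⟩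
    · intro h
      rw [← hcyc, ← h, hcyc]
  have h := mul_count_card_classes (univ.filter fun i => blockPartition w i = ρ) (blockCycle w)
    (fun i hi j => by
      rw [hcyc, ← hcyc', mem_filter]
      refine ⟨fun h => ⟨⟨mem_univ _, ?_⟩, h⟩, fun h => h.2⟩
      rw [hbp i j h, (mem_filter.1 hi).2]) m
  refine Eq.trans ?_ (h.trans ?_)
  · rw [type]
    congr 4
    ext O
    simp only [mem_filter, mem_image, mem_univ, true_and]
    constructor
    · rintro ⟨⟨i, rfl⟩, j, hj, h⟩
      rw [hcyc] at hj
      exact ⟨j, h, (hcyc' i j).1 hj⟩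
    · rintro ⟨i, hi, rfl⟩
      exact ⟨⟨i, rfl⟩, i, (hcyc i i).2 (Equiv.Perm.SameCycle.refl _ _), hi⟩
  · rw [filter_filter]
    simp only [card_blockCycle]

end Points


/-! ### Moved blocks and the reduced type -/

section Reduced

variable {n k : ℕ}

/-- The (indices of the) blocks that are not fixed pointwise by `w`. -/
def moved (w : Equiv.Perm (Fin (n * k))) : Finset (Fin n) :=
  univ.filter fun i => ∃ a : Fin (n * k), a.divNat = i ∧ w a ≠ a

theorem mem_moved {w : Equiv.Perm (Fin (n * k))} {i : Fin n} :
    i ∈ moved w ↔ ∃ a : Fin (n * k), a.divNat = i ∧ w a ≠ a := by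
  simp [moved]

theorem notMem_moved {w : Equiv.Perm (Fin (n * k))} {i : Fin n} :
    i ∉ moved w ↔ ∀ a : Fin (n * k), a.divNat = i → w a = a := by
  simp [moved]

theorem type_pos (w : Equiv.Perm (Fin (n * k))) (ρ : k.Partition) : ∀ m ∈ type w ρ, 0 < m := by
  intro m hm
  obtain ⟨O, hO, rfl⟩ := Multiset.mem_map.1 hm
  obtain ⟨i, hi, -⟩ := (mem_filter.1 (mem_def.2 hO)).2
  exact card_pos.2 ⟨i, hi⟩

/-- A point is fixed exactly when its cycle has length 1. This length is the product of the base and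
fibre counts, so both must equal 1. -/
theorem notMem_moved_iff (hk : 0 < k) {w : Equiv.Perm (Fin (n * k))} (hw : w ∈ group n k)
    (i : Fin n) : i ∉ moved w ↔
      blockPartition w i = onesPartition k ∧ baseOrbitCard Fin.divNat w i = 1 := by
  classical
  obtain ⟨p, hp⟩ := exists_base_perm hk hw
  have hπ := divNat_surjective (n := n) hk
  have hones : blockPartition w i = onesPartition k ↔
      ∀ a : Fin (n * k), a.divNat = i → fiberOrbitCard Fin.divNat w a = 1 := by
    have hcard : (univ.filter fun a : Fin (n * k) => a.divNat = i).card = k := card_block n k i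
    rw [blockPartition_eq_iff]
    constructor
    · intro h a ha
      have h1 := h 1
      rw [← filter_filter, onesPartition, Multiset.count_replicate_self, one_mul] at h1
      -- The points with fibre count 1 number k, so they exhaust the block.
      have h2 := eq_of_subset_of_card_le (filter_subset (fun a : Fin (n * k) =>
        fiberOrbitCard Fin.divNat w a = 1) (univ.filter fun a => a.divNat = i)) (by rw [h1, hcard])
      have h3 : a ∈ univ.filter fun a : Fin (n * k) => a.divNat = i :=
        mem_filter.2 ⟨mem_univ _, ha⟩
      rw [← h2] at h3
      exact (mem_filter.1 h3).2
    · intro h m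
      rw [onesPartition, Multiset.count_replicate, ← filter_filter]
      by_cases hm : m = 1
      · subst hm
        rw [filter_true_of_mem fun a ha => h a (mem_filter.1 ha).2, hcard]
        simp
      · rw [if_neg (Ne.symm hm), mul_zero, card_eq_zero, filter_eq_empty_iff]
        intro a ha h'
        exact hm (h'.symm.trans (h a (mem_filter.1 ha).2))
  rw [hones, notMem_moved]
  have hcyc : ∀ a : Fin (n * k), w a = a ↔ Nat.card {b // w.SameCycle a b} = 1 := by
    intro a
    have h := zpow_apply_eq_self_iff w a 1
    rw [zpow_one] at h
    rw [h, Int.natCast_dvd_ofNat, Nat.dvd_one]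
  constructor
  · intro h
    have h' : ∀ a : Fin (n * k), a.divNat = i →
        baseOrbitCard Fin.divNat w i = 1 ∧ fiberOrbitCard Fin.divNat w a = 1 := by
      intro a ha
      have := (hcyc a).1 (h a ha)
      rw [card_sameCycle hp hπ, ha, mul_eq_one] at this
      exact this
    obtain ⟨a, ha⟩ := hπ i
    exact ⟨fun a ha => (h' a ha).2, (h' a ha).1⟩
  · rintro ⟨h1, h2⟩ a ha
    rw [hcyc, card_sameCycle hp hπ, ha, h1 a ha, h2]

/-- The type of `w` without the parts that come from blocks fixed pointwise. -/
noncomputable def reducedType (w : Equiv.Perm (Fin (n * k))) : Family k where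
  parts := fun ρ => (type w ρ).filter fun m => ¬(ρ = onesPartition k ∧ m = 1)
  parts_pos := fun ρ m hm => type_pos w ρ m (Multiset.mem_of_mem_filter hm)

theorem proper_reducedType (w : Equiv.Perm (Fin (n * k))) : (reducedType w).Proper := by
  intro h
  simp [reducedType] at h

theorem mul_count_reducedType (hk : 0 < k) {w : Equiv.Perm (Fin (n * k))} (hw : w ∈ group n k)
    (ρ : k.Partition) (m : ℕ) :
    m * ((reducedType w).parts ρ).count m = ((moved w).filter fun i =>
      blockPartition w i = ρ ∧ baseOrbitCard Fin.divNat w i = m).card := by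
  classical
  simp only [reducedType]
  by_cases h : ρ = onesPartition k ∧ m = 1
  · rw [Multiset.count_filter_of_neg (by simpa using h), mul_zero, eq_comm, card_eq_zero,
      filter_eq_empty_iff]
    rintro i hi ⟨h1, h2⟩
    exact (notMem_moved_iff hk hw i).2 ⟨h1.trans h.1, h2.trans h.2⟩ hi
  · rw [Multiset.count_filter_of_pos (p := fun m => ¬(ρ = onesPartition k ∧ m = 1)) h, mul_count_type hk hw]
    congr 1
    ext i
    simp only [mem_filter, mem_univ, true_and]
    refine ⟨fun h' => ⟨?_, h'⟩, fun h' => h'.2⟩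
    by_contra hi
    obtain ⟨h1, h2⟩ := (notMem_moved_iff hk hw i).1 hi
    exact h ⟨h'.1.symm.trans h1, h'.2.symm.trans h2⟩

theorem reducedType_eq_iff (hk : 0 < k) {w : Equiv.Perm (Fin (n * k))} (hw : w ∈ group n k)
    (x : Family k) : reducedType w = x ↔ ∀ ρ m, ((moved w).filter fun i =>
      blockPartition w i = ρ ∧ baseOrbitCard Fin.divNat w i = m).card =
        m * (x.parts ρ).count m := by
  constructor
  · rintro rfl ρ m
    rw [mul_count_reducedType hk hw]
  · intro h
    refine Family.ext (funext fun ρ => multiset_eq_of_mul_count ((reducedType w).parts_pos ρ)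
      (x.parts_pos ρ) fun m => ?_)
    rw [mul_count_reducedType hk hw, h]

/-- Each moved block is counted once, under its partition and its cycle length. This equality turns
sizes of families into numbers of blocks, and so yields both the binomials and the degree bound. -/
theorem size_reducedType (hk : 0 < k) {w : Equiv.Perm (Fin (n * k))} (hw : w ∈ group n k) :
    (reducedType w).size = (moved w).card := by
  classical
  rw [Family.size, card_eq_sum_card_fiberwise (f := blockPartition w) (t := univ) (by simp)]
  refine sum_congr rfl fun ρ _ => ?_
  rw [Finset.sum_multiset_count, card_eq_sum_card_fiberwise (f := baseOrbitCard Fin.divNat w)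
    (t := ((reducedType w).parts ρ).toFinset)]
  · refine sum_congr rfl fun m _ => ?_
    rw [smul_eq_mul, mul_comm, mul_count_reducedType hk hw, filter_filter]
  · intro i hi
    have h := mul_count_reducedType hk hw ρ (baseOrbitCard Fin.divNat w i)
    have hpos : 0 < ((moved w).filter fun j => blockPartition w j = ρ ∧
        baseOrbitCard Fin.divNat w j = baseOrbitCard Fin.divNat w i).card := by
      obtain ⟨h1, h2⟩ := mem_filter.1 (mem_coe.1 hi)
      exact card_pos.2 ⟨i, mem_filter.2 ⟨h1, h2, rfl⟩⟩
    rw [← h] at hpos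
    exact mem_coe.2 (Multiset.mem_toFinset.2 (Multiset.count_pos.1 (Nat.pos_of_mul_pos_left hpos)))

theorem type_eq_pad_reducedType (hk : 0 < k) {w : Equiv.Perm (Fin (n * k))} (hw : w ∈ group n k) :
    type w = ((reducedType w).pad n).parts := by
  classical
  funext ρ
  refine multiset_eq_of_mul_count (type_pos w ρ) (((reducedType w).pad n).parts_pos ρ) fun m => ?_
  simp only [Family.pad]
  rw [Multiset.count_add, mul_add, mul_count_reducedType hk hw, mul_count_type hk hw,
    ← card_filter_add_card_filter_not (s := univ.filter fun i =>
      blockPartition w i = ρ ∧ baseOrbitCard Fin.divNat w i = m) (fun i => i ∈ moved w)]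
  congr 1
  · congr 1
    ext i
    simp only [mem_filter, mem_univ, true_and]
    exact and_comm
  · rw [filter_filter]
    by_cases h : ρ = onesPartition k ∧ m = 1
    · obtain ⟨rfl, rfl⟩ := h
      rw [if_pos rfl, Multiset.count_replicate_self, one_mul, size_reducedType hk hw]
      have : (univ.filter fun i => (blockPartition w i = onesPartition k ∧
          baseOrbitCard Fin.divNat w i = 1) ∧ i ∉ moved w) = (moved w)ᶜ := by
        ext i
        simp only [mem_filter, mem_univ, true_and, mem_compl]
        exact ⟨fun h => h.2, fun h => ⟨(notMem_moved_iff hk hw i).1 h, h⟩⟩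
      rw [this, card_compl, Fintype.card_fin]
    · have h1 : Multiset.count m (if ρ = onesPartition k then
          Multiset.replicate (n - (reducedType w).size) 1 else 0) = 0 := by
        split_ifs with hρ
        · rw [Multiset.count_replicate, if_neg fun hm => h ⟨hρ, hm.symm⟩]
        · simp
      rw [h1, mul_zero, card_eq_zero, filter_eq_empty_iff]
      rintro i - ⟨⟨h2, h3⟩, h4⟩
      obtain ⟨h5, h6⟩ := (notMem_moved_iff hk hw i).1 h4
      exact h ⟨h2.symm.trans h5, h3.symm.trans h6⟩

/-- Padding adds exactly the parts that reduction deletes, and a proper family has none of its own.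
Membership in a class is thereby stated without n. -/
theorem type_eq_pad_iff (hk : 0 < k) {w : Equiv.Perm (Fin (n * k))} (hw : w ∈ group n k)
    {x : Family k} (hx : x.Proper) : type w = (x.pad n).parts ↔ reducedType w = x := by
  constructor
  · intro h
    refine Family.ext (funext fun ρ => ?_)
    rw [reducedType]
    simp only [h, Family.pad]
    rw [Multiset.filter_add, Multiset.filter_eq_self.2, Multiset.filter_eq_nil.2, add_zero]
    · intro m hm
      split_ifs at hm with hρ
      · exact not_not.2 ⟨hρ, Multiset.eq_of_mem_replicate hm⟩
      · simp at hm
    · rintro m hm ⟨rfl, rfl⟩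
      exact hx hm
  · rintro rfl
    exact type_eq_pad_reducedType hk hw

theorem IsFiberEmbedding.mem_moved_map {n' : ℕ} {E : Fin (n * k) → Fin (n' * k)}
    {e : Fin n → Fin n'} {w : Equiv.Perm (Fin (n * k))} {w' : Equiv.Perm (Fin (n' * k))}
    (h : IsFiberEmbedding Fin.divNat Fin.divNat E e) (hw : ∀ a, E (w a) = w' (E a)) (i : Fin n) :
    e i ∈ moved w' ↔ i ∈ moved w := by
  rw [mem_moved, mem_moved]
  constructor
  · rintro ⟨b, hb, hne⟩
    obtain ⟨a, rfl⟩ := h.full b i hb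
    rw [h.comm] at hb
    exact ⟨a, h.inj_base hb, fun ha => hne (by rw [← hw, ha])⟩
  · rintro ⟨a, rfl, hne⟩
    exact ⟨E a, h.comm a, fun ha => hne (h.inj (by rw [hw, ha]))⟩

theorem IsFiberEmbedding.moved_map {n' : ℕ} {E : Fin (n * k) → Fin (n' * k)}
    {e : Fin n → Fin n'} {w : Equiv.Perm (Fin (n * k))} {w' : Equiv.Perm (Fin (n' * k))}
    (h : IsFiberEmbedding Fin.divNat Fin.divNat E e) (hw : ∀ a, E (w a) = w' (E a))
    (hr : ∀ i ∈ moved w', i ∈ Set.range e) :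
    moved w' = (moved w).map ⟨e, h.inj_base⟩ := by
  ext i
  rw [mem_map]
  constructor
  · intro hi
    obtain ⟨j, rfl⟩ := hr i hi
    exact ⟨j, (h.mem_moved_map hw j).1 hi, rfl⟩
  · rintro ⟨j, hj, rfl⟩
    exact (h.mem_moved_map hw j).2 hj

/-- Blocks outside the range of e are fixed pointwise and contribute nothing, so the reduced type
does not see the number of blocks. -/
theorem IsFiberEmbedding.reducedType_map {n' : ℕ} (hk : 0 < k) {E : Fin (n * k) → Fin (n' * k)}
    {e : Fin n → Fin n'} {w : Equiv.Perm (Fin (n * k))} {w' : Equiv.Perm (Fin (n' * k))}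
    (h : IsFiberEmbedding Fin.divNat Fin.divNat E e) (hw : ∀ a, E (w a) = w' (E a))
    (hr : ∀ i ∈ moved w', i ∈ Set.range e) (hwg : w ∈ group n k) (hwg' : w' ∈ group n' k) :
    reducedType w' = reducedType w := by
  classical
  rw [reducedType_eq_iff hk hwg']
  intro ρ m
  rw [mul_count_reducedType hk hwg, h.moved_map hw hr, filter_map, card_map]
  simp only [Function.comp_def, Function.Embedding.coeFn_mk, h.blockPartition_map hw,
    h.baseOrbitCard_map hw]

theorem type_eq_of_reducedType_eq (hk : 0 < k) {w w' : Equiv.Perm (Fin (n * k))}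
    (hw : w ∈ group n k) (hw' : w' ∈ group n k) (h : reducedType w = reducedType w') :
    type w = type w' := by
  rw [type_eq_pad_reducedType hk hw, type_eq_pad_reducedType hk hw', h]

end Reduced


/-! ### Equal types imply conjugacy -/

/-- The conjugator is built in two stages, each by `exists_equivariant_equiv`: first a bijection e
of blocks, then a bijection of points lying over e. -/
theorem exists_conj_of_type_eq {n k : ℕ} (hk : 0 < k) {w w' : Equiv.Perm (Fin (n * k))}
    (hw : w ∈ group n k) (hw' : w' ∈ group n k) (h : type w = type w') :
    ∃ g ∈ group n k, g * w * g⁻¹ = w' := by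
  classical
  obtain ⟨p, hp⟩ := exists_base_perm hk hw
  obtain ⟨p', hp'⟩ := exists_base_perm hk hw'
  have hπ := divNat_surjective (n := n) hk
  have hcolor : ∀ {w : Equiv.Perm (Fin (n * k))} {p : Equiv.Perm (Fin n)},
      (∀ a, (w a).divNat = p a.divNat) → ∀ i,
      (blockPartition w (p i), baseOrbitCard Fin.divNat w (p i)) =
        (1 : Equiv.Perm (k.Partition × ℕ))
          (blockPartition w i, baseOrbitCard Fin.divNat w i) := by
    intro w p hp i
    rw [(isFiberEmbedding_self hp).blockPartition_map (fun _ => rfl),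
      (isFiberEmbedding_self hp).baseOrbitCard_map (fun _ => rfl), Equiv.Perm.one_apply]
  -- Blocks are coloured by their partition and cycle length; the type counts each colour.
  obtain ⟨e, he⟩ := exists_equivariant_equiv (σ := p) (σ' := p')
    (c := fun i => (blockPartition w i, baseOrbitCard Fin.divNat w i))
    (c' := fun i => (blockPartition w' i, baseOrbitCard Fin.divNat w' i)) (hcolor hp) (hcolor hp')
    (fun i j hij t => by
      rw [zpow_apply_eq_self_iff, zpow_apply_eq_self_iff, ← baseOrbitCard_eq hp hπ,
        ← baseOrbitCard_eq hp' hπ, (Prod.mk.inj hij).2])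
    (fun γ => by
      simp only [Prod.ext_iff]
      rw [← mul_count_type hk hw, ← mul_count_type hk hw', h])
  simp only [Prod.mk.injEq] at he
  -- Points are coloured by target block and fibre count. The colours move by p' on the blocks,
  -- which forces g to lie over e. The cycle length is the product of the two counts, so equal
  -- colours have equal stabilizers.
  obtain ⟨g, hg⟩ := exists_equivariant_equiv (σ := w) (σ' := w')
    (θ := Equiv.prodCongr p' (Equiv.refl ℕ))
    (c := fun a => (e a.divNat, fiberOrbitCard Fin.divNat w a))
    (c' := fun a => (a.divNat, fiberOrbitCard Fin.divNat w' a))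
    (fun a => by
      rw [hp, (he _).1, (isFiberEmbedding_self hp).fiberOrbitCard_map (fun _ => rfl)]
      rfl)
    (fun a => by
      rw [hp', (isFiberEmbedding_self hp').fiberOrbitCard_map (fun _ => rfl)]
      rfl)
    (fun a b hab t => by
      obtain ⟨h1, h2⟩ := Prod.mk.inj hab
      rw [zpow_apply_eq_self_iff, zpow_apply_eq_self_iff, card_sameCycle hp hπ,
        card_sameCycle hp' hπ, h2, ← h1, (he _).2.2])
    (fun γ => by
      obtain ⟨i, hi⟩ := e.surjective γ.1
      simp only [Prod.ext_iff, ← hi, e.injective.eq_iff]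
      rw [← mul_count_blockPartition, ← mul_count_blockPartition, (he i).2.1])
  refine ⟨g, mem_group_of_base_map e fun a => (Prod.mk.inj (hg a).2).1, ?_⟩
  ext a
  rw [Equiv.Perm.mul_apply, Equiv.Perm.mul_apply, (hg _).1, ← Equiv.Perm.mul_apply g,
    mul_inv_cancel, Equiv.Perm.one_apply]


/-! ### A block permutation of every type -/

section Model

theorem exists_equiv_of_card_fiber {X I : Type*} [Fintype X] [Fintype I] [DecidableEq I]
    {π : X → I} {n k : ℕ} (hI : Fintype.card I = n)
    (hπ : ∀ i, (univ.filter fun a => π a = i).card = k) :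
    ∃ (E : X ≃ Fin (n * k)) (e : I ≃ Fin n), ∀ a, (E a).divNat = e (π a) := by
  have F : ∀ i, {a // π a = i} ≃ Fin k := fun i =>
    Fintype.equivFinOfCardEq (by rw [Fintype.card_subtype, hπ])
  refine ⟨(Equiv.sigmaFiberEquiv π).symm.trans ((Equiv.sigmaCongrRight F).trans
    ((Equiv.sigmaEquivProd I (Fin k)).trans
    ((Equiv.prodCongr (Fintype.equivFinOfCardEq hI) (Equiv.refl _)).trans finProdFinEquiv))),
    Fintype.equivFinOfCardEq hI, fun a => ?_⟩
  exact congrArg Prod.fst (finProdFinEquiv.symm_apply_apply _)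

theorem card_castHom_fiber (l r : ℕ) [NeZero l] [NeZero (l * r)] (y : ZMod l) :
    (univ.filter fun z : ZMod (l * r) =>
      ZMod.castHom (Dvd.intro r rfl) (ZMod l) z = y).card = r := by
  have hs := ZMod.castHom_surjective (Dvd.intro r rfl : l ∣ l * r)
  have h : ∀ y' : ZMod l, (univ.filter fun z : ZMod (l * r) =>
      ZMod.castHom (Dvd.intro r rfl) (ZMod l) z = y').card = (univ.filter fun z : ZMod (l * r) =>
      ZMod.castHom (Dvd.intro r rfl) (ZMod l) z = y).card := fun y' =>
    AddMonoidHom.card_fiber_eq_of_mem_range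
      (ZMod.castHom (Dvd.intro r rfl : l ∣ l * r) (ZMod l)).toAddMonoidHom (hs y') (hs y)
  have h2 := card_eq_sum_card_fiberwise (s := (univ : Finset (ZMod (l * r))))
    (f := ZMod.castHom (Dvd.intro r rfl : l ∣ l * r) (ZMod l)) (t := univ) (by simp)
  rw [sum_congr rfl fun y' _ => h y', sum_const, card_univ, card_univ, ZMod.card, ZMod.card,
    smul_eq_mul] at h2
  exact (Nat.eq_of_mul_eq_mul_left (NeZero.pos l) h2).symm

theorem card_filter_toType (s : Multiset ℕ) (m : ℕ) :
    (univ.filter fun q : s.ToType => q.1 = m).card = s.count m := by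
  conv_rhs => rw [← Multiset.map_univ_coe s, Multiset.count_map]
  simp only [eq_comm (a := m)]
  rfl

variable {P : Type*} {J : P → Type*} (l : P → ℕ) (r : ∀ p, J p → ℕ)

/-- The projection of the disjoint union of cycles of lengths `l p * r p j` to the disjoint union
of cycles of lengths `l p`. -/
def cycleProj (a : Σ p, Σ j : J p, ZMod (l p * r p j)) : Σ p, ZMod (l p) :=
  ⟨a.1, ZMod.castHom (Dvd.intro _ rfl) (ZMod (l a.1)) a.2.2⟩

/-- The rotation by one of all cycles in a disjoint union of cycles. -/
def cycleRotate : Equiv.Perm (Σ p, Σ j : J p, ZMod (l p * r p j)) :=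
  Equiv.sigmaCongrRight fun _ => Equiv.sigmaCongrRight fun _ => Equiv.addRight 1

theorem cycleRotate_zpow (t : ℤ) (p : P) (j : J p) (z : ZMod (l p * r p j)) :
    (cycleRotate l r ^ t) ⟨p, j, z⟩ = ⟨p, j, z + t⟩ := by
  have h := color_zpow (σ := Equiv.addRight (1 : ZMod (l p * r p j))) (θ := cycleRotate l r)
    (c := fun z => ⟨p, j, z⟩) (fun _ => rfl) t z
  rw [← h]
  simp

theorem cycleRotate_sameCycle {p : P} {j : J p} {z : ZMod (l p * r p j)}
    {b : Σ p, Σ j : J p, ZMod (l p * r p j)} :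
    (cycleRotate l r).SameCycle ⟨p, j, z⟩ b ↔ ∃ z', b = ⟨p, j, z'⟩ := by
  constructor
  · rintro ⟨t, rfl⟩
    exact ⟨_, cycleRotate_zpow l r t p j z⟩
  · rintro ⟨z', rfl⟩
    obtain ⟨t, ht⟩ := ZMod.intCast_surjective (z' - z)
    exact ⟨t, by rw [cycleRotate_zpow, ht, add_sub_cancel]⟩

theorem cycleProj_rotate (a : Σ p, Σ j : J p, ZMod (l p * r p j)) :
    cycleProj l r (cycleRotate l r a) = ⟨(cycleProj l r a).1, (cycleProj l r a).2 + 1⟩ := by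
  obtain ⟨p, j, z⟩ := a
  change (⟨p, ZMod.castHom (Dvd.intro _ rfl) (ZMod (l p)) (z + 1)⟩ : Σ p, ZMod (l p)) =
    ⟨p, ZMod.castHom (Dvd.intro _ rfl) (ZMod (l p)) z + 1⟩
  rw [map_add, map_one]

variable {l r}

theorem fiberOrbitCard_cycle (hl : ∀ p, 0 < l p) (hr : ∀ p j, 0 < r p j) (p : P) (j : J p) (z : ZMod (l p * r p j)) :
    fiberOrbitCard (cycleProj l r) (cycleRotate l r) ⟨p, j, z⟩ = r p j := by
  have : NeZero (l p) := ⟨(hl p).ne'⟩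
  have : NeZero (l p * r p j) := ⟨(mul_pos (hl p) (hr p j)).ne'⟩
  rw [fiberOrbitCard, ← card_castHom_fiber (l p) (r p j)
    (ZMod.castHom (Dvd.intro _ rfl) (ZMod (l p)) z), ← Fintype.card_subtype,
    ← Nat.card_eq_fintype_card]
  symm
  refine Nat.card_congr (Equiv.ofBijective (fun z' => ⟨⟨p, j, z'.1⟩, ?_, ?_⟩) ⟨?_, ?_⟩)
  · simp only [cycleProj, z'.2]
  · exact (cycleRotate_sameCycle l r).2 ⟨_, rfl⟩
  · intro z₁ z₂ h
    exact Subtype.ext (by simpa using congrArg Subtype.val h)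
  · rintro ⟨b, hb, hs⟩
    obtain ⟨z', rfl⟩ := (cycleRotate_sameCycle l r).1 hs
    refine ⟨⟨z', ?_⟩, rfl⟩
    simpa [cycleProj] using hb

theorem baseOrbitCard_cycle (hl : ∀ p, 0 < l p) [∀ p, Nonempty (J p)] (i : Σ p, ZMod (l p)) :
    baseOrbitCard (cycleProj l r) (cycleRotate l r) i = l i.1 := by
  obtain ⟨p, y⟩ := i
  have : NeZero (l p) := ⟨(hl p).ne'⟩
  conv_rhs => rw [← Nat.card_zmod (l p)]
  symm
  have hs := fun j => ZMod.castHom_surjective (Dvd.intro (r p j) rfl : l p ∣ l p * r p j)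
  refine Nat.card_congr (Equiv.ofBijective (fun y' => ⟨⟨p, y'⟩, ?_⟩) ⟨?_, ?_⟩)
  · obtain ⟨j⟩ := ‹∀ p, Nonempty (J p)› p
    obtain ⟨z, rfl⟩ := hs j y
    obtain ⟨z', rfl⟩ := hs j y'
    exact ⟨⟨p, j, z⟩, ⟨p, j, z'⟩, rfl, rfl, (cycleRotate_sameCycle l r).2 ⟨_, rfl⟩⟩
  · intro y₁ y₂ h
    simpa [Subtype.ext_iff] using h
  · rintro ⟨_, ⟨p', j, z⟩, b, ha, rfl, hab⟩
    obtain ⟨z', rfl⟩ := (cycleRotate_sameCycle l r).1 hab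
    obtain rfl : p' = p := congrArg Sigma.fst ha
    exact ⟨ZMod.castHom (Dvd.intro _ rfl) (ZMod (l p')) z', rfl⟩

theorem card_cycle_fiber (hl : ∀ p, 0 < l p) (hr : ∀ p j, 0 < r p j)
    [Fintype (Σ p, Σ j : J p, ZMod (l p * r p j))]
    [∀ p, Fintype (J p)] [DecidableEq (Σ p, ZMod (l p))] (i : Σ p, ZMod (l p))
    (q : ∀ p, J p → Prop) [∀ p, DecidablePred (q p)] :
    (univ.filter fun a : Σ p, Σ j : J p, ZMod (l p * r p j) =>
      cycleProj l r a = i ∧ q a.1 a.2.1).card = ∑ j with q i.1 j, r i.1 j := by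
  classical
  obtain ⟨p, y⟩ := i
  have : NeZero (l p) := ⟨(hl p).ne'⟩
  have : ∀ j, NeZero (l p * r p j) := fun j => ⟨(mul_pos (hl p) (hr p j)).ne'⟩
  have h : ∀ j, r p j = (univ.filter fun z : ZMod (l p * r p j) =>
      ZMod.castHom (Dvd.intro _ rfl) (ZMod (l p)) z = y).card :=
    fun j => (card_castHom_fiber (l p) (r p j) y).symm
  rw [sum_congr rfl fun j _ => h j, ← card_sigma]
  symm
  refine card_bij (fun a _ => ⟨p, a⟩) ?_ ?_ ?_
  · rintro ⟨j, z⟩ ha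
    simp only [mem_sigma, mem_filter, mem_univ, true_and] at ha ⊢
    exact ⟨by simp only [cycleProj, ha.2], ha.1⟩
  · rintro a - b - hab
    simpa using hab
  · rintro ⟨p', j, z⟩ ha
    obtain ⟨-, h1, h2⟩ := mem_filter.1 ha
    obtain rfl : p' = p := congrArg Sigma.fst h1
    refine ⟨⟨j, z⟩, ?_, rfl⟩
    simp only [mem_sigma, mem_filter, mem_univ, true_and]
    refine ⟨h2, ?_⟩
    simpa [cycleProj] using h1

end Model

/-- A part l of the partition indexed by ρ becomes a base cycle `ZMod l`. Above it lies one cycle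
`ZMod (l * r)` for each part r of ρ, projected by reduction modulo l. Such a cycle meets each fibre
in r points, so the fibres have k points in all and are cut according to ρ. -/
theorem exists_type_eq {k : ℕ} (hk : 0 < k) (x : Family k) :
    ∃ w ∈ group x.size k, type w = x.parts := by
  classical
  let P := Σ ρ : k.Partition, (x.parts ρ).ToType
  let J : P → Type := fun p => p.1.parts.ToType
  let l : P → ℕ := fun p => p.2.1
  let r : ∀ p, J p → ℕ := fun p j => j.1
  have hl : ∀ p, 0 < l p := fun p => x.parts_pos p.1 _ Multiset.coe_mem
  have hr : ∀ p j, 0 < r p j := fun p j => p.1.parts_pos Multiset.coe_mem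
  have : ∀ p, NeZero (l p) := fun p => ⟨(hl p).ne'⟩
  have : ∀ p j, NeZero (l p * r p j) := fun p j => ⟨(mul_pos (hl p) (hr p j)).ne'⟩
  have hsum : ∀ s : Multiset ℕ, ∑ q : s.ToType, q.1 = s.sum := fun s => by
    conv_rhs => rw [← Multiset.map_univ_coe s]
    rfl
  -- A partition of k > 0 has at least one part, so there are cycles above every base cycle.
  have : ∀ p, Nonempty (J p) := fun p => by
    by_contra h
    rw [not_nonempty_iff] at h
    have h1 := hsum p.1.parts
    rw [p.1.parts_sum, Fintype.sum_empty] at h1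
    exact hk.ne h1
  have hcount : ∀ (ρ : k.Partition) (m : ℕ),
      (univ.filter fun i : Σ p, ZMod (l p) => i.1.1 = ρ ∧ l i.1 = m).card =
        m * (x.parts ρ).count m := by
    intro ρ m
    rw [card_eq_sum_card_fiberwise (f := Sigma.fst)
      (t := univ.filter fun p : P => p.1 = ρ ∧ l p = m) (fun i hi => by simpa using hi),
      sum_const_nat (m := m), mul_comm, ← card_filter_toType]
    · congr 1
      refine (card_bij (fun q _ => (⟨ρ, q⟩ : P)) ?_ ?_ ?_).symm
      · intro q hq
        exact mem_filter.2 ⟨mem_univ _, rfl, (mem_filter.1 hq).2⟩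
      · intro q _ q' _ h
        simpa using h
      · rintro ⟨ρ', q⟩ h
        obtain ⟨-, rfl, hq⟩ := mem_filter.1 h
        exact ⟨q, mem_filter.2 ⟨mem_univ _, hq⟩, rfl⟩
    · intro p hp
      obtain ⟨-, h1, h2⟩ := mem_filter.1 hp
      rw [← h2, ← ZMod.card (l p), ← card_univ]
      refine (card_bij (fun y _ => (⟨p, y⟩ : Σ p, ZMod (l p))) ?_ ?_ ?_).symm
      · intro y _
        simp [h1, h2]
      · intro y _ y' _ h
        simpa using h
      · rintro ⟨p', y⟩ h
        obtain ⟨-, rfl⟩ := mem_filter.1 h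
        exact ⟨y, mem_univ _, rfl⟩
  have hI : Fintype.card (Σ p, ZMod (l p)) = x.size := by
    rw [Fintype.card_sigma, Family.size, Fintype.sum_sigma]
    refine sum_congr rfl fun ρ _ => ?_
    rw [← hsum]
    exact sum_congr rfl fun q _ => ZMod.card _
  obtain ⟨E, e, hEe⟩ := exists_equiv_of_card_fiber (π := cycleProj l r) (k := k) hI fun i => by
    have h := card_cycle_fiber hl hr i fun _ _ => True
    simp only [and_true, filter_true] at h
    rw [h, hsum, i.1.1.parts_sum]
  have hemb : IsFiberEmbedding (cycleProj l r) Fin.divNat E e :=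
    ⟨E.injective, e.injective, hEe, fun b _ _ => E.surjective b⟩
  have hw : ∀ a, E (cycleRotate l r a) = E.permCongr (cycleRotate l r) (E a) := by simp
  have hwg : E.permCongr (cycleRotate l r) ∈ group x.size k := by
    refine mem_group_of_base_map (fun i => e ⟨(e.symm i).1, (e.symm i).2 + 1⟩) fun a => ?_
    obtain ⟨a, rfl⟩ := E.surjective a
    rw [← hw, hEe, hEe, cycleProj_rotate, e.symm_apply_apply]
  refine ⟨E.permCongr (cycleRotate l r), hwg, ?_⟩
  funext ρ
  refine multiset_eq_of_mul_count (type_pos _ ρ) (x.parts_pos ρ) fun m => ?_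
  rw [mul_count_type hk hwg, ← hcount]
  have hbp : ∀ i, blockPartition (E.permCongr (cycleRotate l r)) (e i) = i.1.1 := by
    intro i
    rw [blockPartition_eq_iff]
    intro m
    rw [hemb.card_filter_map hw]
    have h := card_cycle_fiber hl hr i fun p j => r p j = m
    refine Eq.trans ?_ (h.trans ?_)
    · congr 1
      ext ⟨p, j, z⟩
      simp only [mem_filter, mem_univ, true_and, fiberOrbitCard_cycle hl hr]
    · rw [sum_const_nat (m := m) fun j hj => (mem_filter.1 hj).2, mul_comm, ← card_filter_toType]
  refine (card_bij (fun i _ => e i) ?_ (fun _ _ _ _ h => e.injective h) ?_).symm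
  · intro i hi
    simpa [hbp, hemb.baseOrbitCard_map hw, baseOrbitCard_cycle hl] using hi
  · intro i hi
    obtain ⟨i, rfl⟩ := e.surjective i
    refine ⟨i, ?_, rfl⟩
    simpa [hbp, hemb.baseOrbitCard_map hw, baseOrbitCard_cycle hl] using hi

theorem Family.size_pad {k : ℕ} (x : Family k) {n : ℕ} (h : x.size ≤ n) : (x.pad n).size = n := by
  rw [Family.size]
  simp only [Family.pad, Multiset.sum_add, sum_add_distrib]
  have h1 : ∑ ρ, (if ρ = onesPartition k then Multiset.replicate (n - x.size) 1
      else (0 : Multiset ℕ)).sum = n - x.size := by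
    rw [Fintype.sum_eq_single (onesPartition k) fun ρ hρ => by rw [if_neg hρ, Multiset.sum_zero],
      if_pos rfl, Multiset.sum_replicate, smul_eq_mul, mul_one]
  rw [h1]
  exact Nat.add_sub_of_le h

theorem exists_reducedType_eq {k : ℕ} (hk : 0 < k) {x : Family k} (hx : x.Proper) {n : ℕ}
    (h : x.size ≤ n) : ∃ w ∈ group n k, reducedType w = x := by
  obtain ⟨w, hw, ht⟩ := exists_type_eq hk (x.pad n)
  revert w
  rw [x.size_pad h]
  intro w hw ht
  exact ⟨w, hw, (type_eq_pad_iff hk hw hx).1 ht⟩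


/-! ### Extension by the identity to more blocks -/

section Extension

variable {n n' k : ℕ} {E : Fin (n * k) → Fin (n' * k)} {e : Fin n → Fin n'}

theorem exists_isFiberEmbedding (k : ℕ) (e : Fin n ↪ Fin n') :
    ∃ E : Fin (n * k) → Fin (n' * k), IsFiberEmbedding Fin.divNat Fin.divNat E e := by
  have h1 : ∀ {n : ℕ} (p : Fin n × Fin k), (finProdFinEquiv p).divNat = p.1 := fun p =>
    congrArg Prod.fst (finProdFinEquiv.symm_apply_apply p)
  have h2 : ∀ {n : ℕ} (a : Fin (n * k)), ∃ p, finProdFinEquiv p = a :=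
    fun a => finProdFinEquiv.surjective a
  refine ⟨fun a => finProdFinEquiv (e (finProdFinEquiv.symm a).1, (finProdFinEquiv.symm a).2),
    ?_, e.injective, ?_, ?_⟩
  · intro a b h
    have h3 := finProdFinEquiv.injective h
    rw [Prod.mk.injEq, e.injective.eq_iff, ← Prod.ext_iff] at h3
    exact finProdFinEquiv.symm.injective h3
  · intro a
    rw [h1]
    rfl
  · intro b i hb
    obtain ⟨⟨j, c⟩, rfl⟩ := h2 b
    obtain rfl : j = e i := (h1 (j, c)).symm.trans hb
    exact ⟨finProdFinEquiv (i, c), by simp only [Equiv.symm_apply_apply]⟩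

namespace IsFiberEmbedding

variable (h : IsFiberEmbedding (Fin.divNat : Fin (n * k) → Fin n) Fin.divNat E e)

/-- The extension of a permutation along a fibre embedding by the identity. -/
def extend (u : Equiv.Perm (Fin (n * k))) : Equiv.Perm (Fin (n' * k)) :=
  u.viaFintypeEmbedding ⟨E, h.inj⟩

theorem extend_apply (u : Equiv.Perm (Fin (n * k))) (a : Fin (n * k)) :
    E (u a) = h.extend u (E a) :=
  (Equiv.Perm.viaFintypeEmbedding_apply_image u ⟨E, h.inj⟩ a).symm

theorem extend_apply_of_notMem (u : Equiv.Perm (Fin (n * k))) {b : Fin (n' * k)}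
    (hb : b ∉ Set.range E) : h.extend u b = b :=
  Equiv.Perm.viaFintypeEmbedding_apply_notMem_range u ⟨E, h.inj⟩ hb

theorem eq_extend {u : Equiv.Perm (Fin (n * k))} {u' : Equiv.Perm (Fin (n' * k))}
    (hu : ∀ a, E (u a) = u' (E a)) (hr : ∀ i ∈ moved u', i ∈ Set.range e) : h.extend u = u' := by
  ext1 b
  by_cases hb : b ∈ Set.range E
  · obtain ⟨a, rfl⟩ := hb
    rw [← h.extend_apply, hu]
  · rw [h.extend_apply_of_notMem u hb, eq_comm]
    refine notMem_moved.1 (fun hi => hb ?_) b rfl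
    obtain ⟨i, hi⟩ := hr _ hi
    exact h.full b i hi.symm

theorem extend_mul (u v : Equiv.Perm (Fin (n * k))) :
    h.extend (u * v) = h.extend u * h.extend v :=
  (Equiv.Perm.extendDomain_mul _ u v).symm

theorem extend_injective : Function.Injective h.extend := by
  intro u v huv
  ext1 a
  exact h.inj (by rw [h.extend_apply, huv, ← h.extend_apply])

theorem moved_extend (u : Equiv.Perm (Fin (n * k))) : ∀ i ∈ moved (h.extend u), i ∈ Set.range e := by
  intro i hi
  obtain ⟨b, rfl, hb⟩ := mem_moved.1 hi
  by_contra hr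
  refine hb (h.extend_apply_of_notMem u ?_)
  rintro ⟨a, rfl⟩
  exact hr ⟨_, (h.comm a).symm⟩

theorem extend_mem_group (hk : 0 < k) {u : Equiv.Perm (Fin (n * k))} (hu : u ∈ group n k) :
    h.extend u ∈ group n' k := by
  obtain ⟨p, hp⟩ := exists_base_perm hk hu
  refine mem_group_of_base_map (p.viaFintypeEmbedding ⟨e, h.inj_base⟩) fun b => ?_
  by_cases hb : b ∈ Set.range E
  · obtain ⟨a, rfl⟩ := hb
    rw [← h.extend_apply, h.comm, h.comm, hp]
    exact (Equiv.Perm.viaFintypeEmbedding_apply_image p ⟨e, h.inj_base⟩ _).symm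
  · rw [h.extend_apply_of_notMem u hb, Equiv.Perm.viaFintypeEmbedding_apply_notMem_range]
    rintro ⟨i, hi⟩
    exact hb (h.full b i hi.symm)

/-- The image of E is stable under u': all blocks outside it are fixed pointwise, so no point can
enter them. Thus u' restricts. -/
theorem exists_extend_eq (hk : 0 < k) {u' : Equiv.Perm (Fin (n' * k))} (hu' : u' ∈ group n' k)
    (hr : ∀ i ∈ moved u', i ∈ Set.range e) : ∃ u ∈ group n k, h.extend u = u' := by
  obtain ⟨p', hp'⟩ := exists_base_perm hk hu'
  have hf : ∀ a, ∃ b, E b = u' (E a) := by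
    intro a
    by_contra hb
    have h1 : (u' (E a)).divNat ∉ moved u' := by
      intro hi
      obtain ⟨i, hi⟩ := hr _ hi
      exact hb (h.full _ i hi.symm)
    -- If u' (E a) lay in a fixed block, it would be fixed by u', and injectivity would give u' (E
    -- a) = E a.
    exact hb ⟨a, (u'.injective (notMem_moved.1 h1 _ rfl)).symm⟩
  choose f hf using hf
  have hinj : Function.Injective f := fun a b hab =>
    h.inj (u'.injective (by rw [← hf, ← hf, hab]))
  have hq : ∀ i, ∃ j, e j = p' (e i) := by
    intro i
    obtain ⟨a, rfl⟩ := divNat_surjective hk i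
    exact ⟨(f a).divNat, by rw [← h.comm, hf, hp', h.comm]⟩
  choose q hq using hq
  refine ⟨Equiv.ofBijective f (Finite.injective_iff_bijective.1 hinj),
    mem_group_of_base_map q fun a => h.inj_base ?_, h.eq_extend hf hr⟩
  rw [hq, ← h.comm, ← h.comm, ← hp']
  exact congrArg _ (hf a)

theorem reducedType_extend (hk : 0 < k) {u : Equiv.Perm (Fin (n * k))} (hu : u ∈ group n k) :
    reducedType (h.extend u) = reducedType u :=
  h.reducedType_map hk (h.extend_apply u) (h.moved_extend u) hu (h.extend_mem_group hk hu)

end IsFiberEmbedding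

end Extension

/-! ### Counting factorizations by the blocks they move -/

section Count

variable {n k : ℕ}

open Classical in
/-- The factorizations of `w` into factors of reduced types `x` and `y`. -/
noncomputable def factorizations (x y : Family k) (w : Equiv.Perm (Fin (n * k))) :
    Finset (Equiv.Perm (Fin (n * k)) × Equiv.Perm (Fin (n * k))) :=
  univ.filter fun u => (u.1 ∈ group n k ∧ reducedType u.1 = x) ∧
    (u.2 ∈ group n k ∧ reducedType u.2 = y) ∧ u.1 * u.2 = w

/-- The number of factorizations of `w` whose factors together move exactly the blocks in `U`. -/
noncomputable def coverCount (x y : Family k) (w : Equiv.Perm (Fin (n * k))) (U : Finset (Fin n)) :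
    ℕ :=
  ((factorizations x y w).filter fun u => moved u.1 ∪ moved u.2 = U).card

theorem mem_factorizations {x y : Family k} {w : Equiv.Perm (Fin (n * k))}
    {u : Equiv.Perm (Fin (n * k)) × Equiv.Perm (Fin (n * k))} :
    u ∈ factorizations x y w ↔ (u.1 ∈ group n k ∧ reducedType u.1 = x) ∧
      (u.2 ∈ group n k ∧ reducedType u.2 = y) ∧ u.1 * u.2 = w := by
  simp [factorizations]

/-- Extension is injective, multiplicative and preserves reduced types. It reaches every
factorization counted on the left, because both factors move only blocks in the range of e and hence
restrict. -/
theorem IsFiberEmbedding.coverCount_extend {n' : ℕ} {E : Fin (n * k) → Fin (n' * k)}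
    {e : Fin n → Fin n'} (h : IsFiberEmbedding Fin.divNat Fin.divNat E e) (hk : 0 < k)
    (x y : Family k) (w : Equiv.Perm (Fin (n * k))) :
    coverCount x y (h.extend w) (univ.map ⟨e, h.inj_base⟩) = coverCount x y w univ := by
  symm
  refine card_bij (fun u _ => (h.extend u.1, h.extend u.2)) ?_ ?_ ?_
  · rintro ⟨u, v⟩ huv
    rw [mem_filter, mem_factorizations] at huv ⊢
    obtain ⟨⟨⟨hu, rfl⟩, ⟨hv, rfl⟩, rfl⟩, hU⟩ := huv
    refine ⟨⟨⟨h.extend_mem_group hk hu, h.reducedType_extend hk hu⟩,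
      ⟨h.extend_mem_group hk hv, h.reducedType_extend hk hv⟩, (h.extend_mul _ _).symm⟩, ?_⟩
    rw [h.moved_map (h.extend_apply u) (h.moved_extend u),
      h.moved_map (h.extend_apply v) (h.moved_extend v), ← map_union, hU]
  · rintro ⟨u, v⟩ - ⟨u', v'⟩ - huv
    obtain ⟨h1, h2⟩ := Prod.mk.inj huv
    exact Prod.ext (h.extend_injective h1) (h.extend_injective h2)
  · rintro ⟨u', v'⟩ huv
    rw [mem_filter, mem_factorizations] at huv
    obtain ⟨⟨⟨hu, hx⟩, ⟨hv, hy⟩, hw⟩, hU⟩ := huv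
    have hr : ∀ i ∈ moved u' ∪ moved v', i ∈ Set.range e := by
      intro i hi
      rw [hU, mem_map] at hi
      obtain ⟨j, -, hj⟩ := hi
      exact ⟨j, hj⟩
    obtain ⟨u, hu₀, rfl⟩ := h.exists_extend_eq hk hu fun i hi => hr i (mem_union_left _ hi)
    obtain ⟨v, hv₀, rfl⟩ := h.exists_extend_eq hk hv fun i hi => hr i (mem_union_right _ hi)
    replace hx := (h.reducedType_extend hk hu₀).symm.trans hx
    replace hy := (h.reducedType_extend hk hv₀).symm.trans hy
    replace hw := (h.extend_mul u v).trans hw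
    rw [h.moved_map (h.extend_apply u) (h.moved_extend u),
      h.moved_map (h.extend_apply v) (h.moved_extend v), ← map_union] at hU
    exact ⟨(u, v), mem_filter.2 ⟨mem_factorizations.2
      ⟨⟨hu₀, hx⟩, ⟨hv₀, hy⟩, h.extend_injective hw⟩, map_injective _ hU⟩, rfl⟩

theorem coverCount_univ_eq (hk : 0 < k) (x y : Family k) {w w' : Equiv.Perm (Fin (n * k))}
    (hw : w ∈ group n k) (hw' : w' ∈ group n k) (h : reducedType w = reducedType w') :
    coverCount x y w univ = coverCount x y w' univ := by
  obtain ⟨g, hg, rfl⟩ := exists_conj_of_type_eq hk hw hw' (type_eq_of_reducedType_eq hk hw hw' h)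
  obtain ⟨p, hp⟩ := exists_base_perm hk hg
  have hemb := isFiberEmbedding_self hp
  -- Conjugation by g is extension along the embedding given by g itself, so the preceding lemma
  -- also yields invariance under conjugation.
  have hext : hemb.extend w = g * w * g⁻¹ :=
    hemb.eq_extend (by simp) fun i _ => p.surjective i
  rw [← hemb.coverCount_extend hk x y w, hext]
  congr 1
  exact map_univ_equiv p

open Classical in
/-- The number of factorizations, into factors of reduced types `x` and `y` that together move all
blocks, of any block permutation of `m` blocks of reduced type `h`. -/
noncomputable def fullCount (x y h : Family k) (m : ℕ) : ℕ :=
  if hm : ∃ w ∈ group m k, reducedType w = h then coverCount x y hm.choose univ else 0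

/-- The increasing enumeration of U restricts w to a permutation of |U| blocks with the same reduced
type. The representative chosen in `fullCount` is conjugate to this restriction, so the choice is
immaterial. -/
theorem coverCount_eq_fullCount (hk : 0 < k) (x y : Family k) {w : Equiv.Perm (Fin (n * k))}
    (hw : w ∈ group n k) {U : Finset (Fin n)} (hU : moved w ⊆ U) :
    coverCount x y w U = fullCount x y (reducedType w) U.card := by
  obtain ⟨E, hE⟩ := exists_isFiberEmbedding k (U.orderEmbOfFin rfl).toEmbedding
  have hrange : ∀ i ∈ moved w, i ∈ Set.range (U.orderEmbOfFin rfl).toEmbedding := by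
    intro i hi
    change i ∈ Set.range (U.orderEmbOfFin rfl)
    rw [range_orderEmbOfFin]
    exact hU hi
  obtain ⟨w₀, hw₀, rfl⟩ := hE.exists_extend_eq hk hw hrange
  rw [hE.reducedType_extend hk hw₀]
  have hm : ∃ w ∈ group U.card k, reducedType w = reducedType w₀ := ⟨w₀, hw₀, rfl⟩
  rw [fullCount, dif_pos hm, coverCount_univ_eq hk x y hm.choose_spec.1 hw₀ hm.choose_spec.2,
    ← hE.coverCount_extend hk]
  congr 1
  ext i
  rw [← mem_coe, ← range_orderEmbOfFin U rfl, mem_map, Set.mem_range]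
  exact ⟨fun ⟨a, ha⟩ => ⟨a, mem_univ a, ha⟩, fun ⟨a, _, ha⟩ => ⟨a, ha⟩⟩

/-- Factors of reduced types x and y move at most |x| + |y| blocks together. This is the source of
the degree bound. -/
theorem fullCount_eq_zero (hk : 0 < k) {x y h : Family k} {m : ℕ} (hm : x.size + y.size < m) :
    fullCount x y h m = 0 := by
  rw [fullCount]
  split_ifs with hw
  · rw [coverCount, card_eq_zero, filter_eq_empty_iff]
    rintro ⟨u, v⟩ huv hU
    obtain ⟨⟨hu, rfl⟩, ⟨hv, rfl⟩, -⟩ := mem_factorizations.1 huv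
    have h1 := card_union_le (moved u) (moved v)
    rw [hU, card_univ, Fintype.card_fin, ← size_reducedType hk hu, ← size_reducedType hk hv] at h1
    omega
  · rfl

theorem moved_mul_subset (u v : Equiv.Perm (Fin (n * k))) :
    moved (u * v) ⊆ moved u ∪ moved v := by
  intro i hi
  by_contra hn
  rw [mem_union, not_or] at hn
  obtain ⟨a, ha, hne⟩ := mem_moved.1 hi
  rw [Equiv.Perm.mul_apply, notMem_moved.1 hn.2 a ha, notMem_moved.1 hn.1 a ha] at hne
  exact hne rfl

theorem card_factorizations (hk : 0 < k) (x y : Family k) {w : Equiv.Perm (Fin (n * k))}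
    (hw : w ∈ group n k) :
    (factorizations x y w).card = ∑ j ∈ range (x.size + y.size + 1 - (reducedType w).size),
      (n - (reducedType w).size).choose j * fullCount x y (reducedType w)
        ((reducedType w).size + j) := by
  have hsize := size_reducedType hk hw
  -- The fibres are indexed by V, the blocks moved by a factor but not by w. Their number depends
  -- only on |V|, so the sum over subsets becomes a sum of binomials.
  rw [card_eq_sum_card_fiberwise (f := fun u => (moved u.1 ∪ moved u.2) \ moved w)
    (t := (moved w)ᶜ.powerset)]
  · have h1 : ∀ V ∈ (moved w)ᶜ.powerset, ((factorizations x y w).filter fun u =>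
        (moved u.1 ∪ moved u.2) \ moved w = V).card =
        fullCount x y (reducedType w) ((reducedType w).size + V.card) := by
      intro V hV
      have hdisj : Disjoint (moved w) V :=
        disjoint_left.2 fun i hi hi' => mem_compl.1 (mem_powerset.1 hV hi') hi
      rw [hsize, ← card_union_of_disjoint hdisj,
        ← coverCount_eq_fullCount hk x y hw subset_union_left, coverCount]
      congr 1
      refine filter_congr fun u hu => ?_
      have hsub : moved w ⊆ moved u.1 ∪ moved u.2 := by
        rw [← (mem_factorizations.1 hu).2.2]
        exact moved_mul_subset _ _
      constructor
      · rintro rfl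
        rw [union_sdiff_of_subset hsub]
      · intro h
        rw [h, union_sdiff_cancel_left hdisj]
    rw [sum_congr rfl h1, sum_powerset_apply_card (fun j => fullCount x y (reducedType w)
      ((reducedType w).size + j)), card_compl, Fintype.card_fin, ← hsize]
    simp only [smul_eq_mul]
    -- The sum over subsets stops at j = n - |h|, the claimed one at j = |x| + |y| - |h|. Both
    -- extend to the larger range: past the first bound the binomial vanishes, past the second
    -- `fullCount` does.
    have h2 : ∀ a b : ℕ, (∀ j, a ≤ j → (n - (reducedType w).size).choose j *
        fullCount x y (reducedType w) ((reducedType w).size + j) = 0) →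
        ∑ j ∈ range (max a b), (n - (reducedType w).size).choose j *
          fullCount x y (reducedType w) ((reducedType w).size + j) =
        ∑ j ∈ range a, (n - (reducedType w).size).choose j *
          fullCount x y (reducedType w) ((reducedType w).size + j) := by
      intro a b h
      refine (sum_subset (range_subset_range.2 (le_max_left a b)) fun j _ hj => h j ?_).symm
      simpa using hj
    rw [← h2 _ (x.size + y.size + 1 - (reducedType w).size) fun j hj => by
      rw [Nat.choose_eq_zero_of_lt (by omega), zero_mul], max_comm, h2 _ _ fun j hj => by
      rw [fullCount_eq_zero hk (by omega), mul_zero]]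
  · intro u _
    rw [mem_coe, mem_powerset]
    exact fun i hi => mem_compl.2 (mem_sdiff.1 hi).2

end Count


/-! ### Structure coefficients as numbers of factorizations -/

section StructureCoefficients

variable {n k : ℕ}

open Classical in
theorem coeff_classSum (hk : 0 < k) {z : Family k} (hz : z.Proper) (g : group n k) :
    (z.classSum n).coeff g = if reducedType g.1 = z then 1 else 0 := by
  rw [Family.classSum, MonoidAlgebra.coeff_sum, Finsupp.finsetSum_apply]
  simp only [MonoidAlgebra.of_apply, MonoidAlgebra.coeff_single, Finsupp.single_apply]
  rw [sum_ite_eq']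
  simp only [mem_filter, mem_univ, true_and, type_eq_pad_iff hk g.2 hz]

theorem coeff_classSum_mul (hk : 0 < k) {x y : Family k} (hx : x.Proper) (hy : y.Proper)
    (g : group n k) :
    (x.classSum n * y.classSum n).coeff g = ((factorizations x y g.1).card : ℂ) := by
  classical
  rw [Family.classSum, Family.classSum, sum_mul_sum, ← sum_product',
    MonoidAlgebra.coeff_sum, Finsupp.finsetSum_apply]
  simp only [← map_mul]
  simp only [MonoidAlgebra.of_apply, MonoidAlgebra.coeff_single, Finsupp.single_apply]
  rw [sum_boole]
  congr 1
  refine card_bij (fun u _ => (u.1.1, u.2.1)) ?_ ?_ ?_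
  · rintro ⟨u, v⟩ h
    simp only [mem_filter, mem_product, mem_univ, true_and, type_eq_pad_iff hk u.2 hx,
      type_eq_pad_iff hk v.2 hy] at h
    exact mem_factorizations.2 ⟨⟨u.2, h.1.1⟩, ⟨v.2, h.1.2⟩, congrArg Subtype.val h.2⟩
  · rintro ⟨u, v⟩ - ⟨u', v'⟩ - h
    obtain ⟨h1, h2⟩ := Prod.mk.inj h
    exact Prod.ext (Subtype.ext h1) (Subtype.ext h2)
  · rintro ⟨u, v⟩ h
    obtain ⟨⟨hu, hux⟩, ⟨hv, hvy⟩, hw⟩ := mem_factorizations.1 h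
    refine ⟨(⟨u, hu⟩, ⟨v, hv⟩), ?_, rfl⟩
    simp only [mem_filter, mem_product, mem_univ, true_and, type_eq_pad_iff hk hu hx,
      type_eq_pad_iff hk hv hy]
    exact ⟨⟨hux, hvy⟩, Subtype.ext hw⟩

/-- At a group element g only the class sum indexed by the reduced type of g is nonzero, with value
1, so comparing coefficients at g isolates a single c z. -/
theorem isStructureCoeffs_iff (hk : 0 < k) {x y : Family k} (hx : x.Proper) (hy : y.Proper)
    (c : Family k →₀ ℂ) : x.IsStructureCoeffs y n c ↔
      (∀ z ∈ c.support, z.Proper ∧ z.size ≤ n) ∧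
      ∀ g : group n k, c (reducedType g.1) = ((factorizations x y g.1).card : ℂ) := by
  classical
  refine and_congr_right fun hc => ?_
  have h : ∀ g : group n k, (c.sum fun z a => a • z.classSum n).coeff g = c (reducedType g.1) := by
    intro g
    rw [Finsupp.sum, MonoidAlgebra.coeff_sum, Finsupp.finsetSum_apply]
    have h1 : ∀ z ∈ c.support, (c z • z.classSum n).coeff g =
        if reducedType g.1 = z then c z else 0 := by
      intro z hz
      rw [MonoidAlgebra.coeff_smul_apply, coeff_classSum hk (hc z hz).1, smul_eq_mul, mul_ite,
        mul_one, mul_zero]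
    rw [sum_congr rfl h1, sum_ite_eq, ite_eq_left_iff]
    intro h0
    exact (Finsupp.notMem_support_iff.1 h0).symm
  constructor
  · intro heq g
    rw [← h, ← heq, coeff_classSum_mul hk hx hy]
  · intro heq
    ext g
    rw [h, heq, coeff_classSum_mul hk hx hy]

theorem card_factorizations_congr (hk : 0 < k) (x y : Family k) {w w' : Equiv.Perm (Fin (n * k))}
    (hw : w ∈ group n k) (hw' : w' ∈ group n k) (h : reducedType w = reducedType w') :
    (factorizations x y w).card = (factorizations x y w').card := by
  rw [card_factorizations hk x y hw, card_factorizations hk x y hw', h]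

theorem size_reducedType_le (hk : 0 < k) {w : Equiv.Perm (Fin (n * k))} (hw : w ∈ group n k) :
    (reducedType w).size ≤ n := by
  rw [size_reducedType hk hw]
  exact (card_le_univ _).trans_eq (Fintype.card_fin n)

/-- Existence holds because the number of factorizations depends only on the reduced type;
uniqueness because every proper family of size at most n is the reduced type of some group element.
-/
theorem existsUnique_structureCoeffs (hk : 0 < k) {x y : Family k} (hx : x.Proper)
    (hy : y.Proper) (n : ℕ) : ∃! c : Family k →₀ ℂ, x.IsStructureCoeffs y n c := by
  classical
  let f : Family k → ℂ := fun z =>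
    if h : ∃ g : group n k, reducedType g.1 = z then
      ((factorizations x y h.choose.1).card : ℂ) else 0
  have hf : ∀ g : group n k, f (reducedType g.1) = ((factorizations x y g.1).card : ℂ) := by
    intro g
    have h : ∃ g' : group n k, reducedType g'.1 = reducedType g.1 := ⟨g, rfl⟩
    simp only [f, dif_pos h]
    rw [card_factorizations_congr hk x y h.choose.2 g.2 h.choose_spec]
  have hsupp : ∀ z, f z ≠ 0 → z ∈ univ.image fun g : group n k => reducedType g.1 := by
    intro z hz
    by_contra h
    refine hz (dif_neg ?_)
    rintro ⟨g, hg⟩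
    exact h (mem_image.2 ⟨g, mem_univ g, hg⟩)
  refine ⟨Finsupp.onFinset _ f hsupp, ?_, ?_⟩
  · refine (isStructureCoeffs_iff hk hx hy _).2 ⟨fun z hz => ?_, hf⟩
    obtain ⟨g, -, rfl⟩ := mem_image.1 (hsupp z (Finsupp.mem_support_iff.1 hz))
    exact ⟨proper_reducedType g.1, size_reducedType_le hk g.2⟩
  · intro c hc
    obtain ⟨hc1, hc2⟩ := (isStructureCoeffs_iff hk hx hy _).1 hc
    ext z
    rw [Finsupp.onFinset_apply]
    by_cases hz : z.Proper ∧ z.size ≤ n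
    · obtain ⟨w, hw, rfl⟩ := exists_reducedType_eq hk hz.1 hz.2
      exact (hc2 ⟨w, hw⟩).trans (hf ⟨w, hw⟩).symm
    · rw [Finsupp.notMem_support_iff.1 fun h => hz (hc1 z h), eq_comm]
      refine dif_neg ?_
      rintro ⟨g, rfl⟩
      exact hz ⟨proper_reducedType g.1, size_reducedType_le hk g.2⟩

/-- The coefficients, in the basis of shifted falling factorials, of the polynomial that gives the
structure coefficient of `h` in the product of the class sums of `x` and `y`. -/
noncomputable def fallingCoeff (x y h : Family k) : ℕ →₀ ℚ :=
  ∑ j ∈ range (x.size + y.size + 1 - h.size),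
    Finsupp.single j ((fullCount x y h (h.size + j) : ℚ) / j.factorial)

theorem fallingCoeff_sum {A : Type*} [AddCommMonoid A] (x y h : Family k) (F : ℕ → ℚ → A)
    (h0 : ∀ j, F j 0 = 0) (hadd : ∀ j a b, F j (a + b) = F j a + F j b) :
    (fallingCoeff x y h).sum F = ∑ j ∈ range (x.size + y.size + 1 - h.size),
      F j ((fullCount x y h (h.size + j) : ℚ) / j.factorial) := by
  rw [fallingCoeff, ← Finsupp.sum_finsetSum_index h0 hadd]
  exact sum_congr rfl fun j _ => Finsupp.sum_single_index (h0 j)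

theorem fallingCoeff_nonneg (x y h : Family k) (j : ℕ) : 0 ≤ fallingCoeff x y h j := by
  rw [fallingCoeff, Finsupp.finsetSum_apply]
  refine sum_nonneg fun i _ => ?_
  rw [Finsupp.single_apply]
  split_ifs
  · positivity
  · exact le_rfl

open Polynomial in
theorem degree_falling_comp_le (s j : ℕ) (a : ℚ) :
    (C a * (descPochhammer ℚ j).comp (X - C (s : ℚ))).degree ≤ (j : WithBot ℕ) := by
  refine degree_le_of_natDegree_le ((natDegree_C_mul_le a _).trans ?_)
  refine natDegree_comp_le.trans ?_
  rw [descPochhammer_natDegree, natDegree_X_sub_C, mul_one]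

end StructureCoefficients

end BlockPerm

open BlockPerm Finset in
theorem mainTheorem1 (k : ℕ) (hk : 0 < k) (x y h : BlockPerm.Family k)
    (hx : x.Proper) (hy : y.Proper) (hh : h.Proper) :
    ∃ (P : Polynomial ℚ) (b : ℕ →₀ ℚ),
      (∀ j, 0 ≤ b j) ∧
      P = (b.sum fun j a => Polynomial.C a *
        (descPochhammer ℚ j).comp (Polynomial.X - Polynomial.C (h.size : ℚ))) ∧
      P.degree + (h.size : WithBot ℕ) ≤ ((x.size + y.size : ℕ) : WithBot ℕ) ∧
      ∀ n : ℕ, x.size < n → y.size < n → h.size < n →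
        (∃! c : BlockPerm.Family k →₀ ℂ, x.IsStructureCoeffs y n c) ∧
        ∀ c : BlockPerm.Family k →₀ ℂ, x.IsStructureCoeffs y n c →
          c h = ((P.eval (n : ℚ) : ℚ) : ℂ) := by
  have hsum := fallingCoeff_sum x y h (fun j a => Polynomial.C a *
    (descPochhammer ℚ j).comp (Polynomial.X - Polynomial.C (h.size : ℚ))) (by simp)
    (fun j a b => by rw [Polynomial.C_add, add_mul])
  refine ⟨_, fallingCoeff x y h, fallingCoeff_nonneg x y h, rfl, ?_,
    fun n _ _ hn => ⟨existsUnique_structureCoeffs hk hx hy n, fun c hc => ?_⟩⟩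
  · rw [hsum]
    -- If |h| > |x| + |y|, the truncated range of j is empty and P = 0, of degree ⊥.
    rcases lt_or_ge (x.size + y.size) h.size with hlt | hle
    · rw [Nat.sub_eq_zero_of_le hlt, range_zero, sum_empty, Polynomial.degree_zero, WithBot.bot_add]
      exact bot_le
    · calc _ ≤ ((x.size + y.size - h.size : ℕ) : WithBot ℕ) + (h.size : WithBot ℕ) := by
            gcongr
            refine (Polynomial.degree_sum_le _ _).trans (Finset.sup_le fun j hj => ?_)
            refine (degree_falling_comp_le _ j _).trans (Nat.cast_le.2 ?_)
            have := mem_range.1 hj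
            omega
        _ = _ := by rw [← Nat.cast_add, Nat.sub_add_cancel hle]
  · obtain ⟨w, hw, rfl⟩ := exists_reducedType_eq hk hh hn.le
    have hc2 := ((isStructureCoeffs_iff hk hx hy c).1 hc).2 ⟨w, hw⟩
    rw [hc2, hsum, Polynomial.eval_finsetSum, card_factorizations hk x y hw, Nat.cast_sum,
      Rat.cast_sum]
    refine sum_congr rfl fun j _ => ?_
    -- Since |h| ≤ n, the falling factorial at n is that of the natural number n - |h|, that is j!
    -- times a binomial; the j! cancels the denominator in `fallingCoeff`.
    rw [Polynomial.eval_mul, Polynomial.eval_C, Polynomial.eval_comp, Polynomial.eval_sub,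
      Polynomial.eval_X, Polynomial.eval_C, ← Nat.cast_sub hn.le,
      descPochhammer_eval_eq_descFactorial, Nat.descFactorial_eq_factorial_mul_choose]
    have hj : (j.factorial : ℂ) ≠ 0 := Nat.cast_ne_zero.2 j.factorial_ne_zero
    push_cast
    field_simp
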